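/- **Theorem.** A conjunctive query without self-joins $Q(\mathbf A):-R_1(\mathbb A_1),\dots,R_m(\mathbb A_m)$ has distinct relation symbols $R_i$ over finite attribute sets $\mathbb A_i$ and a set of output attributes $\mathbf A\subseteq \mathbb A:=\bigcup_i \mathbb A_i$. A database $D$ for $Q$ consists of a finite set $R_i^D$ of tuples over $\mathbb A_i$ for every $i$; its size is $N=|D|=\sum_i |R_i^D|$; and $Q(D)$ is the projection onto $\mathbf A$ of the natural join $R_1^D\Join\cdots\Join R_m^D$. A witness for $D$ is a sub-database $D'\subseteq D$ with $Q(D')=Q(D)$. A smallest witness is a witness $D^*$ of minimum size $|D^*|$. Let $Q$ be a conjunctive query without self-joins that has exactly one non-output attribute, i.e. $|\mathbb A\setminus\mathbf A|=1$ (for example, a star query $Q(A_1,\dots,A_m):-R_1(A_1,B),\dots,R_m(A_m,B)$). Then the smallest witness problem for $Q$ is $O(\log N)$-approximable in polynomial time: there are a function $\theta$ with $\theta(N)=O(\log N)$ as $N\to\infty$ and an algorithm that, for every database $D$ for $Q$ with $N=|D|$, computes in time polynomial in $N$ a witness $D'$ for $D$ with $|D'|\le\theta(N)\cdot|D^*|$,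 where $D^*$ is a smallest witness for $D$. Here $Q$ is fixed, so $\theta$, the algorithm and the polynomial may depend on $Q$ (data complexity), attribute values are natural numbers, and time is the number of steps of a random access machine on which copying, addition, truncated subtraction, testing for zero, and reading or writing a memory cell are single steps. -/

import Mathlib

open Filter Asymptotics

/-- A conjunctive query without self-joins
`Q(head) :- R_0(attr 0), ..., R_{numRels-1}(attr (numRels-1))`.
Attributes are named by natural numbers. The relation symbols are the (distinct) indices
`i : Fin numRels`; different symbols may have equal attribute sets. -/
structure CQ where
  /-- the number of relations in the body -/
  numRels : ℕ
  /-- the attributes of each relation -/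
  attr : Fin numRels → Finset ℕ
  /-- the output attributes -/
  head : Finset ℕ
  /-- the output attributes appear in the body -/
  head_subset : head ⊆ Finset.univ.biUnion attr

namespace CQ

/-- All attributes that appear in the body of the query. -/
def attrs (Q : CQ) : Finset ℕ := Finset.univ.biUnion Q.attr

/-- The non-output (existential) attributes. -/
def nonOutput (Q : CQ) : Finset ℕ := Q.attrs \ Q.head

/-- A tuple over a set of attributes; the values are natural numbers. -/
abbrev Tuple (X : Finset ℕ) : Type := X → ℕ

/-- The projection of a tuple onto a subset of its attributes. -/
def proj {X Y : Finset ℕ} (h : Y ⊆ X) (t : Tuple X) : Tuple Y := fun a => t ⟨a.1, h a.2⟩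

theorem attr_subset_attrs (Q : CQ) (i : Fin Q.numRels) : Q.attr i ⊆ Q.attrs :=
  Finset.subset_biUnion_of_mem Q.attr (Finset.mem_univ i)

theorem head_subset_attrs (Q : CQ) : Q.head ⊆ Q.attrs := Q.head_subset

/-- A database for `Q`: a finite set of tuples for each relation. -/
abbrev Database (Q : CQ) : Type := (i : Fin Q.numRels) → Finset (Tuple (Q.attr i))

/-- The number of tuples of a database (the input size `N`). -/
def Database.size {Q : CQ} (D : Q.Database) : ℕ := ∑ i, (D i).card

/-- The natural join of all relations. -/
def join (Q : CQ) (D : Q.Database) : Set (Tuple Q.attrs) :=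
  {s | ∀ i, proj (Q.attr_subset_attrs i) s ∈ D i}

/-- The query result `Q(D)`: the projection of the natural join onto the output attributes. -/
def result (Q : CQ) (D : Q.Database) : Set (Tuple Q.head) :=
  proj Q.head_subset_attrs '' Q.join D

/-- `D'` is a witness for `D`: a sub-database with the same query result. -/
def IsWitness (Q : CQ) (D D' : Q.Database) : Prop :=
  (∀ i, D' i ⊆ D i) ∧ Q.result D' = Q.result D

/-- `D'` is a solution to the smallest witness problem on `D`. -/
def IsSmallestWitness (Q : CQ) (D D' : Q.Database) : Prop :=
  Q.IsWitness D D' ∧ ∀ D'' : Q.Database, Q.IsWitness D D'' → D'.size ≤ D''.size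

/-- `D'` is a `θ`-approximated solution to the smallest witness problem on `D`. -/
def IsApproxSmallestWitness (Q : CQ) (θ : ℝ) (D D' : Q.Database) : Prop :=
  Q.IsWitness D D' ∧
    ∀ Dstar : Q.Database, Q.IsSmallestWitness D Dstar → (D'.size : ℝ) ≤ θ * (Dstar.size : ℝ)

end CQ

/-! A random access machine with uniform cost. It has registers and arrays (both indexed by
natural numbers; a program only names finitely many of them), all of whose cells hold natural
numbers. The arithmetic operations are addition and truncated subtraction; multiplication is
deliberately not a unit-cost operation, so that polynomially many steps are polynomial time also
on a Turing machine. -/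
namespace RAM

/-- Memory contents: `reg x` is register `x`, and `mem a p` is cell `p` of array `a`. -/
structure State where
  /-- the registers -/
  reg : ℕ → ℕ
  /-- the arrays -/
  mem : ℕ → ℕ → ℕ

/-- `r_x := v` -/
def State.setReg (s : State) (x v : ℕ) : State :=
  { s with reg := Function.update s.reg x v }

/-- `M_a[p] := v` -/
def State.setMem (s : State) (a p v : ℕ) : State :=
  { s with mem := Function.update s.mem a (Function.update (s.mem a) p v) }

/-- Programs. -/
inductive Prog : Type
  /-- do nothing -/
  | skip : Prog
  /-- `r_x := c` for a constant `c` -/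
  | const (x c : ℕ) : Prog
  /-- `r_x := r_y` -/
  | move (x y : ℕ) : Prog
  /-- `r_x := r_y + r_z` -/
  | add (x y z : ℕ) : Prog
  /-- `r_x := r_y - r_z`, which is `0` if `r_y ≤ r_z` -/
  | sub (x y z : ℕ) : Prog
  /-- `r_x := M_a[r_y]` -/
  | load (x a y : ℕ) : Prog
  /-- `M_a[r_y] := r_x` -/
  | store (a y x : ℕ) : Prog
  /-- `P; P'` -/
  | seq (P P' : Prog) : Prog
  /-- if `r_x ≠ 0` then `P` else `P'` -/
  | ifNZ (x : ℕ) (P P' : Prog) : Prog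
  /-- while `r_x ≠ 0` do `P` -/
  | whileNZ (x : ℕ) (P : Prog) : Prog

/-- `Exec P s n s'`: started in the memory `s`, the program `P` halts after exactly `n` steps with
the memory `s'`. Every elementary instruction and every test of a register is one step. -/
inductive Exec : Prog → State → ℕ → State → Prop
  | skip (s : State) : Exec .skip s 1 s
  | const (s : State) (x c : ℕ) : Exec (.const x c) s 1 (s.setReg x c)
  | move (s : State) (x y : ℕ) : Exec (.move x y) s 1 (s.setReg x (s.reg y))
  | add (s : State) (x y z : ℕ) : Exec (.add x y z) s 1 (s.setReg x (s.reg y + s.reg z))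
  | sub (s : State) (x y z : ℕ) : Exec (.sub x y z) s 1 (s.setReg x (s.reg y - s.reg z))
  | load (s : State) (x a y : ℕ) : Exec (.load x a y) s 1 (s.setReg x (s.mem a (s.reg y)))
  | store (s : State) (a y x : ℕ) : Exec (.store a y x) s 1 (s.setMem a (s.reg y) (s.reg x))
  | seq {P P' : Prog} {s s' s'' : State} {n n' : ℕ} :
      Exec P s n s' → Exec P' s' n' s'' → Exec (.seq P P') s (n + n') s''
  | ifTrue {x : ℕ} {P P' : Prog} {s s' : State} {n : ℕ} :
      s.reg x ≠ 0 → Exec P s n s' → Exec (.ifNZ x P P') s (n + 1) s'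
  | ifFalse {x : ℕ} {P P' : Prog} {s s' : State} {n : ℕ} :
      s.reg x = 0 → Exec P' s n s' → Exec (.ifNZ x P P') s (n + 1) s'
  | whileTrue {x : ℕ} {P : Prog} {s s' s'' : State} {n n' : ℕ} :
      s.reg x ≠ 0 → Exec P s n s' → Exec (.whileNZ x P) s' n' s'' →
        Exec (.whileNZ x P) s (n + n' + 1) s''
  | whileFalse {x : ℕ} {P : Prog} {s : State} :
      s.reg x = 0 → Exec (.whileNZ x P) s 1 s

end RAM

namespace CQ

/-- A table for each relation: the rows of the relation, listed in some order. -/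
abbrev Tables (Q : CQ) : Type := (i : Fin Q.numRels) → List (Tuple (Q.attr i))

/-- The tables list every tuple of the database exactly once. -/
def Lists (Q : CQ) (T : Q.Tables) (D : Q.Database) : Prop :=
  ∀ i, (T i).Nodup ∧ (T i).toFinset = D i

/-- The values of a tuple, with the attributes in increasing order. -/
def row {X : Finset ℕ} (t : Tuple X) : List ℕ :=
  List.ofFn fun c : Fin X.card => t (X.orderIsoOfFin rfl c)

/-- The values of a table, row after row. -/
def cells {X : Finset ℕ} (l : List (Tuple X)) : List ℕ := l.flatMap row

/-- The initial memory of the machine on given input tables: register `i` holds the number of rows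
of relation `i`, array `i` holds these rows one after the other, all other cells are `0`. -/
def inputState (Q : CQ) (T : Q.Tables) : RAM.State where
  reg x := if h : x < Q.numRels then (T ⟨x, h⟩).length else 0
  mem a p := if h : a < Q.numRels then (cells (T ⟨a, h⟩)).getD p 0 else 0

/-- The memory `s` contains the tables `T` as output, in the format of the input; the other cells
are arbitrary. -/
def Outputs (Q : CQ) (s : RAM.State) (T : Q.Tables) : Prop :=
  ∀ i : Fin Q.numRels, s.reg i = (T i).length ∧
    ∀ p < (cells (T i)).length, s.mem i p = (cells (T i)).getD p 0

/-- The smallest witness problem is `θ`-approximable for `Q`, where `θ` may depend on the input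
size: a fixed program computes, from each database `D` with `N` tuples (listed in any order), a
`θ N`-approximated solution, in a number of steps that is polynomial in `N`. -/
def SWPApproximable (Q : CQ) (θ : ℕ → ℝ) : Prop :=
  ∃ (P : RAM.Prog) (p : Polynomial ℕ), ∀ (D : Q.Database) (T : Q.Tables), Q.Lists T D →
    ∃ (n : ℕ) (s : RAM.State) (D' : Q.Database) (T' : Q.Tables),
      RAM.Exec P (Q.inputState T) n s ∧ n ≤ p.eval D.size ∧
      Q.Outputs s T' ∧ Q.Lists T' D' ∧ Q.IsApproxSmallestWitness (θ D.size) D D'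

end CQ

/-! Let `β` be the only non-output attribute. Rows of tables without `β` consist of output values,
so any such row used by the join lies in every witness; keeping all of them costs at most the size
of a smallest witness (`length_solutionRows_le`). The remaining task is a covering problem on a
hypergraph. The vertices are the rows of tables with `β`, coloured by their `β`-value; the edges are
the joinable choices of one row per table. Each edge is monochromatic, and its colour and output
determine it (`colored`). A set of vertices is needed that contains, for every output, all vertices
of some edge with this output.

The greedy algorithm lowers a threshold `d` step by step. Peeling off vertices of degree less than
`d` from the hypergraph of uncovered edges leaves the `d`-core. As long as the core is nonempty,
some colour class `P` of the core is selected. Two estimates control the cost, with `b` bounding the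
size of an edge and `u` the number of uncovered outputs: (1) Every vertex of `P` has degree at least
`d` inside `P`, and the edges inside `P` have distinct outputs, so double counting gives at least `d
* |P| / b` newly covered outputs (`numUncovered_union_le`). (2) The `(d + 1)`-core was emptied
earlier, so the uncovered hypergraph is `d`-degenerate. Any feasible `R` contains an edge for each
uncovered output, whence `u ≤ d * |R|` (`Thin.numUncovered_le`). If `u` drops to `u'`, then together
`|P| ≤ b * |R| * (u - u') / u`, and these costs telescope along the harmonic numbers
(`sub_div_le_harmonic_sub`, `potential_union_le`). The total is at most `b * |R| * (1 + log |E|)`,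
where the number `|E|` of edges is at most `N ^ k` for `k` tables. A core is found by iterated
peeling, so no densest-subgraph computation is needed.

For the running time, the algorithm is written as a composition of memory transformations from a
small calculus (`PExpr`, `PPred`, `PCmd`) closed under loops up to a common limit that is linear in
`N`. Its members compile to polynomial-time programs, and `GreedyState` ties the memory to the
abstract algorithm. -/

/-! ### Compiling expressions and memory transformations to polynomial-time programs -/

namespace RAM

/-- The memory, with the arrays grouped into blocks of `k` arrays each. -/
abbrev Blocks (k : ℕ) : Type := ℕ → Fin k → ℕ → ℕ

/-- Array `i` of block `K` is the array `K * k + i` of the machine. -/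
def view (k : ℕ) (m : ℕ → ℕ → ℕ) : Blocks k := fun K i p => m (K * k + i) p

theorem block_index_inj {k K K' : ℕ} {i i' : Fin k} :
    K * k + (i : ℕ) = K' * k + i' ↔ K = K' ∧ i = i' := by
  have hk : 0 < k := i.pos
  constructor
  · intro h
    have h1 : (K * k + (i : ℕ)) / k = K := by
      rw [mul_comm, Nat.mul_add_div hk, Nat.div_eq_of_lt i.2, add_zero]
    have h2 : (K' * k + (i' : ℕ)) / k = K' := by
      rw [mul_comm, Nat.mul_add_div hk, Nat.div_eq_of_lt i'.2, add_zero]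
    have hK : K = K' := by rw [← h1, ← h2, h]
    subst hK
    exact ⟨rfl, Fin.ext (by omega)⟩
  · rintro ⟨rfl, rfl⟩; rfl

/-- Overwrite one cell of one array of a block. -/
def setCell {k : ℕ} (K : ℕ) (i : Fin k) (p v : ℕ) (m : Blocks k) : Blocks k :=
  Function.update m K (Function.update (m K) i (Function.update (m K i) p v))

theorem view_setMem {k : ℕ} (s : State) (K : ℕ) (i : Fin k) (p v : ℕ) :
    view k (s.setMem (K * k + i) p v).mem = setCell K i p v (view k s.mem) := by
  funext K' i' p'
  simp only [view, State.setMem, setCell, Function.update_apply, block_index_inj]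
  by_cases hK : K' = K
  · subst hK
    by_cases hi : i' = i
    · subst hi; simp [Function.update_apply, view]
    · simp [hi, view]
  · simp [hK, view]

/-- The common limit of all loops: a cell of block `2`. -/
def lim {k : ℕ} (i₀ : Fin k) (m : Blocks k) : ℕ := m 2 i₀ 0

theorem lim_update {k : ℕ} (i₀ : Fin k) (m : Blocks k) {K : ℕ} (hK : K ≠ 2)
    (g : Fin k → ℕ → ℕ) : lim i₀ (Function.update m K g) = lim i₀ m := by
  simp [lim, Function.update_of_ne hK.symm]

section Loop

/-- The invariant is indexed by the number of iterations still to run, so termination, the time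
bound and the final state come from one induction. -/
theorem Exec.while_of_invariant {x : ℕ} {P : Prog} {b : ℕ} (I : ℕ → State → Prop)
    (h0 : ∀ s, I 0 s → s.reg x = 0)
    (hs : ∀ r s, I (r + 1) s → s.reg x ≠ 0 ∧ ∃ n s', Exec P s n s' ∧ n ≤ b ∧ I r s')
    (r : ℕ) (s : State) (h : I r s) :
    ∃ n s', Exec (.whileNZ x P) s n s' ∧ n ≤ r * (b + 1) + 1 ∧ I 0 s' := by
  induction r generalizing s with
  | zero => exact ⟨1, s, .whileFalse (h0 s h), by omega, h⟩
  | succ r ih =>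
    obtain ⟨hx, n, s', he, hn, hI⟩ := hs r s h
    obtain ⟨n', s'', he', hn', hI'⟩ := ih s' hI
    exact ⟨_, s'', .whileTrue hx he he', by rw [Nat.succ_mul]; omega, hI'⟩

end Loop

/-- The expression `e` over the index variables `ι` and the memory is computable by a program in
a number of steps that is polynomial in the loop limit. The program leaves its result in register
`d` and keeps the memory and all registers below `d`, where the variables are kept. -/
def PExpr {k : ℕ} (i₀ : Fin k) {ι : Type} (e : (ι → ℕ) → Blocks k → ℕ) : Prop :=
  ∀ (pos : ι → ℕ) (d : ℕ), (∀ i, pos i < d) →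
    ∃ (P : Prog) (p : Polynomial ℕ), ∀ s : State, ∃ (n : ℕ) (s' : State),
      Exec P s n s' ∧ n ≤ p.eval (lim i₀ (view k s.mem)) ∧ s'.mem = s.mem ∧
      (∀ z < d, s'.reg z = s.reg z) ∧ s'.reg d = e (fun i => s.reg (pos i)) (view k s.mem)

/-- The memory transformation `f` is computable by a program in a number of steps that is
polynomial in the loop limit; it keeps the loop limit, and the program keeps the registers
below `d`. -/
def PCmd {k : ℕ} (i₀ : Fin k) {ι : Type} (f : (ι → ℕ) → Blocks k → Blocks k) : Prop :=
  (∀ x m, lim i₀ (f x m) = lim i₀ m) ∧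
  ∀ (pos : ι → ℕ) (d : ℕ), (∀ i, pos i < d) →
    ∃ (P : Prog) (p : Polynomial ℕ), ∀ s : State, ∃ (n : ℕ) (s' : State),
      Exec P s n s' ∧ n ≤ p.eval (lim i₀ (view k s.mem)) ∧
      (∀ z < d, s'.reg z = s.reg z) ∧ view k s'.mem = f (fun i => s.reg (pos i)) (view k s.mem)

open Classical in
/-- The indicator of the predicate `p` is computable in polynomial time. -/
def PPred {k : ℕ} (i₀ : Fin k) {ι : Type} (p : (ι → ℕ) → Blocks k → Prop) : Prop :=
  PExpr i₀ fun x m => if p x m then 1 else 0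

variable {k : ℕ} {i₀ : Fin k} {ι ι' : Type}

@[simp] theorem State.setReg_mem (s : State) (x v : ℕ) : (s.setReg x v).mem = s.mem := rfl

theorem State.setReg_reg (s : State) (x v z : ℕ) :
    (s.setReg x v).reg z = if z = x then v else s.reg z := by
  simp [State.setReg, Function.update_apply]

@[simp] theorem State.setMem_reg (s : State) (a p v : ℕ) : (s.setMem a p v).reg = s.reg := rfl

/-! ### Computable expressions -/

namespace PExpr

theorem congr {e e' : (ι → ℕ) → Blocks k → ℕ} (he : PExpr i₀ e) (h : ∀ x m, e' x m = e x m) :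
    PExpr i₀ e' := by
  rwa [show e' = e from funext fun x => funext fun m => h x m]

theorem reindex {e : (ι → ℕ) → Blocks k → ℕ} (he : PExpr i₀ e) (ρ : ι → ι') :
    PExpr i₀ fun (x : ι' → ℕ) m => e (fun i => x (ρ i)) m :=
  fun pos d hd => he (fun i => pos (ρ i)) d fun i => hd (ρ i)

theorem var (i : ι) : PExpr i₀ fun x _ => x i := fun pos d hd =>
  ⟨.move d (pos i), 1, fun s => ⟨1, _, .move s d (pos i), by simp, rfl,
    fun z hz => by simp [State.setReg_reg, hz.ne], by simp [State.setReg_reg]⟩⟩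

theorem const (c : ℕ) : PExpr i₀ fun (_ : ι → ℕ) _ => c := fun _ d _ =>
  ⟨.const d c, 1, fun s => ⟨1, _, .const s d c, by simp, rfl,
    fun z hz => by simp [State.setReg_reg, hz.ne], by simp [State.setReg_reg]⟩⟩

theorem read (K : ℕ) (i : Fin k) {e : (ι → ℕ) → Blocks k → ℕ} (he : PExpr i₀ e) :
    PExpr i₀ fun x m => m K i (e x m) := by
  intro pos d hd
  obtain ⟨P, p, hP⟩ := he pos d hd
  refine ⟨.seq P (.load d (K * k + i) d), p + 1, fun s => ?_⟩
  obtain ⟨n, s', h, hn, hm, hr, hv⟩ := hP s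
  refine ⟨_, _, .seq h (.load s' d _ d), by simpa using hn, hm, fun z hz => ?_, ?_⟩
  · simp [State.setReg_reg, hz.ne, hr z hz]
  · simp [State.setReg_reg, hv, hm, view]

/-- Registers act as a stack: the first operand waits in register `d` while the second is evaluated
above it into `d + 1`. The first evaluation keeps the memory, so both operands see the same memory.
-/
theorem binop {e₁ e₂ : (ι → ℕ) → Blocks k → ℕ} (h₁ : PExpr i₀ e₁) (h₂ : PExpr i₀ e₂)
    (op : ℕ → ℕ → ℕ) (instr : ℕ → Prog)
    (hop : ∀ d s, Exec (instr d) s 1 (s.setReg d (op (s.reg d) (s.reg (d + 1))))) :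
    PExpr i₀ fun x m => op (e₁ x m) (e₂ x m) := by
  intro pos d hd
  obtain ⟨P₁, p₁, hP₁⟩ := h₁ pos d hd
  obtain ⟨P₂, p₂, hP₂⟩ := h₂ pos (d + 1) fun i => (hd i).trans (Nat.lt_succ_self d)
  refine ⟨.seq P₁ (.seq P₂ (instr d)), p₁ + (p₂ + 1), fun s => ?_⟩
  obtain ⟨n₁, s₁, hx₁, hn₁, hm₁, hr₁, hv₁⟩ := hP₁ s
  obtain ⟨n₂, s₂, hx₂, hn₂, hm₂, hr₂, hv₂⟩ := hP₂ s₁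
  refine ⟨_, _, .seq hx₁ (.seq hx₂ (hop d s₂)), ?_, ?_, fun z hz => ?_, ?_⟩
  · rw [hm₁] at hn₂
    simp only [Polynomial.eval_add, Polynomial.eval_one]
    omega
  · simp [hm₁, hm₂]
  · simp [State.setReg_reg, hz.ne, hr₂ z (hz.trans (Nat.lt_succ_self d)), hr₁ z hz]
  · have hpos : (fun i => s₁.reg (pos i)) = fun i => s.reg (pos i) :=
      funext fun i => hr₁ _ (hd i)
    simp [State.setReg_reg, hv₂, hr₂ d (Nat.lt_succ_self d), hv₁, hm₁, hpos]

theorem add {e₁ e₂ : (ι → ℕ) → Blocks k → ℕ} (h₁ : PExpr i₀ e₁) (h₂ : PExpr i₀ e₂) :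
    PExpr i₀ fun x m => e₁ x m + e₂ x m :=
  binop h₁ h₂ (· + ·) (fun d => .add d d (d + 1)) fun d s => .add s d d (d + 1)

theorem sub {e₁ e₂ : (ι → ℕ) → Blocks k → ℕ} (h₁ : PExpr i₀ e₁) (h₂ : PExpr i₀ e₂) :
    PExpr i₀ fun x m => e₁ x m - e₂ x m :=
  binop h₁ h₂ (· - ·) (fun d => .sub d d (d + 1)) fun d s => .sub s d d (d + 1)

theorem mul_const {e : (ι → ℕ) → Blocks k → ℕ} (h : PExpr i₀ e) (c : ℕ) :
    PExpr i₀ fun x m => e x m * c := by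
  induction c with
  | zero => exact const 0
  | succ c ih => exact add ih h

theorem ite_ne_zero {c e₁ e₂ : (ι → ℕ) → Blocks k → ℕ} (hc : PExpr i₀ c) (h₁ : PExpr i₀ e₁)
    (h₂ : PExpr i₀ e₂) : PExpr i₀ fun x m => if c x m ≠ 0 then e₁ x m else e₂ x m := by
  intro pos d hd
  obtain ⟨P, p, hP⟩ := hc pos d hd
  obtain ⟨P₁, p₁, hP₁⟩ := h₁ pos d hd
  obtain ⟨P₂, p₂, hP₂⟩ := h₂ pos d hd
  refine ⟨.seq P (.ifNZ d P₁ P₂), p + p₁ + p₂ + 1, fun s => ?_⟩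
  obtain ⟨n, s', hx, hn, hm, hr, hv⟩ := hP s
  have hpos : (fun i => s'.reg (pos i)) = fun i => s.reg (pos i) := funext fun i => hr _ (hd i)
  simp only [Polynomial.eval_add, Polynomial.eval_one]
  by_cases h0 : s'.reg d = 0
  · obtain ⟨n₂, s₂, hx₂, hn₂, hm₂, hr₂, hv₂⟩ := hP₂ s'
    refine ⟨_, _, .seq hx (.ifFalse h0 hx₂), ?_, hm₂.trans hm,
      fun z hz => (hr₂ z hz).trans (hr z hz), ?_⟩
    · rw [hm] at hn₂; omega
    · rw [hv] at h0
      simp [hv₂, hm, hpos, h0]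
  · obtain ⟨n₁, s₁, hx₁, hn₁, hm₁, hr₁, hv₁⟩ := hP₁ s'
    refine ⟨_, _, .seq hx (.ifTrue h0 hx₁), ?_, hm₁.trans hm,
      fun z hz => (hr₁ z hz).trans (hr z hz), ?_⟩
    · rw [hm] at hn₁; omega
    · rw [hv] at h0
      simp [hv₁, hm, hpos, h0]

theorem ite {c : (ι → ℕ) → Blocks k → Prop} [∀ x m, Decidable (c x m)]
    {e₁ e₂ : (ι → ℕ) → Blocks k → ℕ} (hc : PPred i₀ c) (h₁ : PExpr i₀ e₁)
    (h₂ : PExpr i₀ e₂) : PExpr i₀ fun x m => if c x m then e₁ x m else e₂ x m := by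
  convert ite_ne_zero hc h₁ h₂ using 4 with x m
  by_cases h : c x m <;> simp [h]

/-- Register `d` gets the loop limit. -/
theorem exec_lim (i₀ : Fin k) (d : ℕ) (s : State) :
    ∃ s', Exec (.seq (.const d 0) (.load d (2 * k + i₀) d)) s 2 s' ∧ s'.mem = s.mem ∧
      (∀ z, z ≠ d → s'.reg z = s.reg z) ∧ s'.reg d = lim i₀ (view k s.mem) :=
  ⟨_, .seq (.const s d 0) (.load _ d _ d), rfl, fun z hz => by simp [State.setReg_reg, hz],
    by simp [State.setReg_reg, lim, view]⟩

/-- The sum over an index variable below the limit. -/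
theorem sum {e : (ι → ℕ) → ℕ → Blocks k → ℕ}
    (he : PExpr i₀ fun (y : Option ι → ℕ) m => e (fun i => y (some i)) (y none) m) :
    PExpr i₀ fun x m => ∑ j ∈ Finset.range (lim i₀ m), e x j m := by
  intro pos d hd
  obtain ⟨P, p, hP⟩ := he (fun o => o.elim (d + 2) pos) (d + 4) (by
    rintro (_ | i)
    · simp
    · exact (hd i).trans (by omega))
  -- Register `d` accumulates the sum, `d + 1` counts the remaining iterations, `d + 2` is the index
  -- variable, `d + 3` holds the constant 1, and the summand is left in `d + 4`.
  refine ⟨.seq (.seq (.const (d + 1) 0) (.load (d + 1) (2 * k + i₀) (d + 1)))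
    (.seq (.const d 0) (.seq (.const (d + 2) 0) (.seq (.const (d + 3) 1)
      (.whileNZ (d + 1) (.seq P (.seq (.add d d (d + 4))
        (.seq (.add (d + 2) (d + 2) (d + 3)) (.sub (d + 1) (d + 1) (d + 3))))))))),
    Polynomial.X * (p + 4) + 6, fun s => ?_⟩
  obtain ⟨s₁, hx₁, hm₁, hr₁, hv₁⟩ := exec_lim i₀ (d + 1) s
  set L := lim i₀ (view k s.mem) with hL
  let I : ℕ → State → Prop := fun r t => r ≤ L ∧ t.mem = s.mem ∧ (∀ z < d, t.reg z = s.reg z) ∧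
    t.reg (d + 1) = r ∧ t.reg (d + 2) = L - r ∧ t.reg (d + 3) = 1 ∧
    t.reg d = ∑ j ∈ Finset.range (L - r), e (fun i => s.reg (pos i)) j (view k s.mem)
  obtain ⟨n, s', hx, hn, -, hm', hr', -, -, -, hv'⟩ := Exec.while_of_invariant (x := d + 1)
    (P := .seq P (.seq (.add d d (d + 4))
        (.seq (.add (d + 2) (d + 2) (d + 3)) (.sub (d + 1) (d + 1) (d + 3)))))
    (b := p.eval L + 3) I (fun t ht => ht.2.2.2.1) (by
      rintro r t ⟨hrL, hm, hr, h1, h2, h3, h0⟩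
      refine ⟨by omega, ?_⟩
      obtain ⟨n, t', hx, hn, hm', hr', hv⟩ := hP t
      refine ⟨_, _, .seq hx (.seq (.add _ _ _ _) (.seq (.add _ _ _ _) (.sub _ _ _ _))), ?_, ?_⟩
      · rw [hm, ← hL] at hn; omega
      · have e0 := hr' d (by omega)
        have e1 := hr' (d + 1) (by omega)
        have e2 := hr' (d + 2) (by omega)
        have e3 := hr' (d + 3) (by omega)
        refine ⟨by omega, by simp [hm', hm], fun z hz => ?_, ?_, ?_, ?_, ?_⟩
        · simp [State.setReg_reg, show z ≠ d + 1 by omega, show z ≠ d + 2 by omega, hz.ne,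
            hr' z (by omega), hr z hz]
        · simp [State.setReg_reg, e1, e3, h1, h3]
        · simp [State.setReg_reg, e2, e3, h2, h3]; omega
        · simp [State.setReg_reg, e3, h3]
        · have hpos : (fun i => t.reg (pos i)) = fun i => s.reg (pos i) :=
            funext fun i => hr _ (hd i)
          have : L - r = (L - (r + 1)) + 1 := by omega
          simp only [Option.elim] at hv
          rw [this, Finset.sum_range_succ, ← h0, ← h2, ← hpos, ← hm, ← hv]
          simp [State.setReg_reg, e0])
    L (((s₁.setReg d 0).setReg (d + 2) 0).setReg (d + 3) 1) (by
      refine ⟨le_rfl, by simpa using hm₁, fun z hz => ?_, ?_, ?_, ?_, ?_⟩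
      · simp [State.setReg_reg, show z ≠ d + 3 by omega, show z ≠ d + 2 by omega, hz.ne,
          hr₁ z (by omega)]
      · simp [State.setReg_reg, hv₁]
      · simp [State.setReg_reg]
      · simp [State.setReg_reg]
      · simp [State.setReg_reg])
  refine ⟨_, s', .seq hx₁ (.seq (.const _ _ _) (.seq (.const _ _ _) (.seq (.const _ _ _) hx))),
    ?_, hm', hr', by simpa using hv'⟩
  simp only [Polynomial.eval_add, Polynomial.eval_mul, Polynomial.eval_X, Polynomial.eval_ofNat]
  have : L * (p.eval L + 3 + 1) = L * (p.eval L + 4) := by ring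
  omega

theorem sum_finset {κ : Type*} (F : Finset κ) {e : κ → (ι → ℕ) → Blocks k → ℕ}
    (he : ∀ c ∈ F, PExpr i₀ (e c)) : PExpr i₀ fun x m => ∑ c ∈ F, e c x m := by
  classical
  induction F using Finset.induction_on with
  | empty => exact (const 0).congr fun x m => by simp
  | insert c F hc ih =>
    exact ((he c (Finset.mem_insert_self c F)).add
      (ih fun c' h => he c' (Finset.mem_insert_of_mem h))).congr fun x m => by
        simp [Finset.sum_insert hc]

/-- The sum over finitely many index variables below the limit. -/
theorem sum_pi {n : ℕ} {e : (ι → ℕ) → (Fin n → ℕ) → Blocks k → ℕ}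
    (he : PExpr i₀ fun (y : ι ⊕ Fin n → ℕ) m =>
      e (fun i => y (.inl i)) (fun c => y (.inr c)) m) :
    PExpr i₀ fun x m =>
      ∑ J ∈ Fintype.piFinset fun _ : Fin n => Finset.range (lim i₀ m), e x J m := by
  induction n generalizing ι with
  | zero =>
    convert he.reindex (Sum.elim id Fin.elim0) using 3 with x m
    rw [Fintype.piFinset_of_isEmpty, Finset.univ_unique, Finset.sum_singleton]
    congr 1
    exact Subsingleton.elim _ _
  | succ n ih =>
    have h := sum (e := fun x j m => ∑ J ∈ Fintype.piFinset fun _ : Fin n =>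
      Finset.range (lim i₀ m), e x (Fin.cons j J) m) (i₀ := i₀) (ι := ι) (ih (by
        -- The variable of the new outer loop becomes component 0 of the tuple; the inner loops
        -- supply the tail.
        convert he.reindex (ι' := Option ι ⊕ Fin n)
          (Sum.elim (fun i => .inl (some i)) (Fin.cons (.inl none) .inr)) using 3 with y m
        simp only [Sum.elim_inl, Sum.elim_inr]
        congr 1
        funext c
        refine Fin.cases ?_ (fun c => ?_) c <;> simp))
    refine h.congr fun x m => ?_
    rw [← Finset.sum_product']
    refine Finset.sum_bij' (fun J _ => (J 0, Fin.tail J)) (fun q _ => Fin.cons q.1 q.2)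
      ?_ ?_ ?_ ?_ ?_
    · intro J hJ
      simp only [Fintype.mem_piFinset, Finset.mem_range, Finset.mem_product] at hJ ⊢
      exact ⟨hJ 0, fun c => hJ c.succ⟩
    · intro q hq
      simp only [Fintype.mem_piFinset, Finset.mem_range, Finset.mem_product] at hq ⊢
      refine Fin.cases ?_ fun c => ?_
      · simpa using hq.1
      · simpa using hq.2 c
    · intro J _; simp
    · intro q _; simp
    · intro J _; simp

end PExpr

/-! ### Computable predicates -/

namespace PPred

theorem congr {p q : (ι → ℕ) → Blocks k → Prop} (hp : PPred i₀ p) (h : ∀ x m, q x m ↔ p x m) :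
    PPred i₀ q := by
  rwa [show q = p from funext fun x => funext fun m => propext (h x m)]

theorem const (p : Prop) : PPred i₀ fun (_ : ι → ℕ) _ => p := PExpr.const _

theorem le {e₁ e₂ : (ι → ℕ) → Blocks k → ℕ} (h₁ : PExpr i₀ e₁) (h₂ : PExpr i₀ e₂) :
    PPred i₀ fun x m => e₁ x m ≤ e₂ x m :=
  ((PExpr.const 1).sub (h₁.sub h₂)).congr fun x m => by split_ifs <;> omega

theorem lt {e₁ e₂ : (ι → ℕ) → Blocks k → ℕ} (h₁ : PExpr i₀ e₁) (h₂ : PExpr i₀ e₂) :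
    PPred i₀ fun x m => e₁ x m < e₂ x m :=
  le (h₁.add (.const 1)) h₂

theorem not {p : (ι → ℕ) → Blocks k → Prop} (hp : PPred i₀ p) : PPred i₀ fun x m => ¬p x m :=
  ((PExpr.const 1).sub hp).congr fun x m => by by_cases h : p x m <;> simp [h]

theorem and {p q : (ι → ℕ) → Blocks k → Prop} (hp : PPred i₀ p) (hq : PPred i₀ q) :
    PPred i₀ fun x m => p x m ∧ q x m := by
  classical
  exact (PExpr.ite hp hq (.const 0)).congr fun x m => by by_cases h : p x m <;> simp [h]

theorem or {p q : (ι → ℕ) → Blocks k → Prop} (hp : PPred i₀ p) (hq : PPred i₀ q) :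
    PPred i₀ fun x m => p x m ∨ q x m :=
  (hp.not.and hq.not).not.congr fun x m => by tauto

theorem eq {e₁ e₂ : (ι → ℕ) → Blocks k → ℕ} (h₁ : PExpr i₀ e₁) (h₂ : PExpr i₀ e₂) :
    PPred i₀ fun x m => e₁ x m = e₂ x m :=
  ((le h₁ h₂).and (le h₂ h₁)).congr fun _ _ => le_antisymm_iff

theorem forall_finset {κ : Type*} (F : Finset κ) {p : κ → (ι → ℕ) → Blocks k → Prop}
    (hp : ∀ c ∈ F, PPred i₀ (p c)) : PPred i₀ fun x m => ∀ c ∈ F, p c x m := by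
  classical
  induction F using Finset.induction_on with
  | empty => exact (const True).congr fun x m => by simp
  | insert c F hc ih =>
    exact ((hp c (Finset.mem_insert_self c F)).and
      (ih fun c' h => hp c' (Finset.mem_insert_of_mem h))).congr fun x m => by simp

theorem forall_fintype {κ : Type*} [Fintype κ] {p : κ → (ι → ℕ) → Blocks k → Prop}
    (hp : ∀ c, PPred i₀ (p c)) : PPred i₀ fun x m => ∀ c, p c x m :=
  (forall_finset Finset.univ fun c _ => hp c).congr fun x m => by simp

/-- Existential quantification over finitely many index variables below the limit. -/
theorem exists_pi {n : ℕ} {p : (ι → ℕ) → (Fin n → ℕ) → Blocks k → Prop}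
    (hp : PPred i₀ fun (y : ι ⊕ Fin n → ℕ) m =>
      p (fun i => y (.inl i)) (fun c => y (.inr c)) m) :
    PPred i₀ fun x m => ∃ J : Fin n → ℕ, (∀ c, J c < lim i₀ m) ∧ p x J m := by
  classical
  have h : PExpr i₀ fun x m => ∑ J ∈ Fintype.piFinset fun _ : Fin n => Finset.range (lim i₀ m),
      if p x J m then 1 else 0 := PExpr.sum_pi hp
  -- A tuple with the property exists iff the number of such tuples is nonzero; the whole range is
  -- counted, without early exit.
  refine (eq h (.const 0)).not.congr fun x m => ?_
  simp [Fintype.mem_piFinset]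

end PPred

/-! ### Computable memory transformations -/

namespace PCmd

theorem reindex {f : (ι → ℕ) → Blocks k → Blocks k} (hf : PCmd i₀ f) (ρ : ι → ι') :
    PCmd i₀ fun (x : ι' → ℕ) m => f (fun i => x (ρ i)) m :=
  ⟨fun _ m => hf.1 _ m, fun pos d hd => hf.2 (fun i => pos (ρ i)) d fun i => hd (ρ i)⟩

theorem skip : PCmd i₀ fun (_ : ι → ℕ) m => m :=
  ⟨fun _ _ => rfl, fun _ _ _ => ⟨.skip, 1, fun s => ⟨1, s, .skip s, by simp, fun _ _ => rfl, rfl⟩⟩⟩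

/-- The time bounds simply add because the first command keeps the limit, so both polynomials are
evaluated at the same number. -/
theorem comp {f g : (ι → ℕ) → Blocks k → Blocks k} (hg : PCmd i₀ g) (hf : PCmd i₀ f) :
    PCmd i₀ fun x m => g x (f x m) := by
  refine ⟨fun x m => (hg.1 _ _).trans (hf.1 _ _), fun pos d hd => ?_⟩
  obtain ⟨P₁, p₁, hP₁⟩ := hf.2 pos d hd
  obtain ⟨P₂, p₂, hP₂⟩ := hg.2 pos d hd
  refine ⟨.seq P₁ P₂, p₁ + p₂, fun s => ?_⟩
  obtain ⟨n₁, s₁, hx₁, hn₁, hr₁, hv₁⟩ := hP₁ s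
  obtain ⟨n₂, s₂, hx₂, hn₂, hr₂, hv₂⟩ := hP₂ s₁
  have hpos : (fun i => s₁.reg (pos i)) = fun i => s.reg (pos i) := funext fun i => hr₁ _ (hd i)
  refine ⟨_, _, .seq hx₁ hx₂, ?_, fun z hz => (hr₂ z hz).trans (hr₁ z hz), ?_⟩
  · rw [hv₁, hf.1] at hn₂
    simp only [Polynomial.eval_add]
    omega
  · rw [hv₂, hv₁, hpos]

theorem setCell {K : ℕ} (hK : K ≠ 2) (i : Fin k) {a e : (ι → ℕ) → Blocks k → ℕ}
    (ha : PExpr i₀ a) (he : PExpr i₀ e) :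
    PCmd i₀ fun x m => setCell K i (a x m) (e x m) m := by
  refine ⟨fun x m => lim_update i₀ m hK _, fun pos d hd => ?_⟩
  obtain ⟨P₁, p₁, hP₁⟩ := ha pos d hd
  obtain ⟨P₂, p₂, hP₂⟩ := he pos (d + 1) fun i => (hd i).trans (Nat.lt_succ_self d)
  refine ⟨.seq P₁ (.seq P₂ (.store (K * k + i) d (d + 1))), p₁ + (p₂ + 1), fun s => ?_⟩
  obtain ⟨n₁, s₁, hx₁, hn₁, hm₁, hr₁, hv₁⟩ := hP₁ s
  obtain ⟨n₂, s₂, hx₂, hn₂, hm₂, hr₂, hv₂⟩ := hP₂ s₁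
  have hpos : (fun i => s₁.reg (pos i)) = fun i => s.reg (pos i) := funext fun i => hr₁ _ (hd i)
  refine ⟨_, _, .seq hx₁ (.seq hx₂ (.store s₂ _ _ _)), ?_, fun z hz => ?_, ?_⟩
  · rw [hm₁] at hn₂
    simp only [Polynomial.eval_add, Polynomial.eval_one]
    omega
  · simp [hr₂ z (hz.trans (Nat.lt_succ_self d)), hr₁ z hz]
  · rw [view_setMem, hm₂, hm₁, hv₂, hr₂ d (Nat.lt_succ_self d), hv₁, hpos, hm₁]

/-- A loop over an index variable below the limit. -/
theorem forLoop {f : (ι → ℕ) → ℕ → Blocks k → Blocks k}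
    (hf : PCmd i₀ fun (y : Option ι → ℕ) m => f (fun i => y (some i)) (y none) m) :
    PCmd i₀ fun x m => (List.range (lim i₀ m)).foldl (fun m j => f x j m) m := by
  have hlim : ∀ x j m, lim i₀ (f x j m) = lim i₀ m := fun x j m =>
    hf.1 (fun o => o.elim j x) m
  have hfold : ∀ x (l : List ℕ) m, lim i₀ (l.foldl (fun m j => f x j m) m) = lim i₀ m := by
    intro x l
    induction l with
    | nil => intro m; rfl
    | cons j l ih => intro m; rw [List.foldl_cons, ih, hlim]
  refine ⟨fun x m => hfold x _ m, fun pos d hd => ?_⟩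
  obtain ⟨P, p, hP⟩ := hf.2 (fun o => o.elim (d + 1) pos) (d + 3) (by
    rintro (_ | i)
    · simp
    · exact (hd i).trans (by omega))
  -- Register `d` counts down, `d + 1` is the index variable, `d + 2` holds the constant 1, and the
  -- body works from `d + 3` upwards.
  refine ⟨.seq (.seq (.const d 0) (.load d (2 * k + i₀) d))
    (.seq (.const (d + 1) 0) (.seq (.const (d + 2) 1)
      (.whileNZ d (.seq P
        (.seq (.add (d + 1) (d + 1) (d + 2)) (.sub d d (d + 2))))))),
    Polynomial.X * (p + 3) + 5, fun s => ?_⟩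
  obtain ⟨s₁, hx₁, hm₁, hr₁, hv₁⟩ := PExpr.exec_lim i₀ d s
  set L := lim i₀ (view k s.mem) with hL
  let I : ℕ → State → Prop := fun r t => r ≤ L ∧ (∀ z < d, t.reg z = s.reg z) ∧
    t.reg d = r ∧ t.reg (d + 1) = L - r ∧ t.reg (d + 2) = 1 ∧
    view k t.mem = (List.range (L - r)).foldl (fun m j => f (fun i => s.reg (pos i)) j m)
      (view k s.mem)
  obtain ⟨n, s', hx, hn, -, hr', -, -, -, hv'⟩ := Exec.while_of_invariant (x := d)
    (P := .seq P (.seq (.add (d + 1) (d + 1) (d + 2)) (.sub d d (d + 2))))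
    (b := p.eval L + 2) I (fun t ht => ht.2.2.1) (by
      rintro r t ⟨hrL, hr, h1, h2, h3, h0⟩
      refine ⟨by omega, ?_⟩
      obtain ⟨n, t', hx, hn, hr', hv⟩ := hP t
      refine ⟨_, _, .seq hx (.seq (.add _ _ _ _) (.sub _ _ _ _)), ?_, ?_⟩
      · rw [h0, hfold, ← hL] at hn; omega
      · have e0 := hr' d (by omega)
        have e1 := hr' (d + 1) (by omega)
        have e2 := hr' (d + 2) (by omega)
        refine ⟨by omega, fun z hz => ?_, ?_, ?_, ?_, ?_⟩
        · simp [State.setReg_reg, show z ≠ d + 1 by omega, hz.ne, hr' z (by omega), hr z hz]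
        · simp [State.setReg_reg, e0, e2, h1, h3]
        · simp [State.setReg_reg, e1, e2, h2, h3]; omega
        · simp [State.setReg_reg, e2, h3]
        · have hpos : (fun i => t.reg (pos i)) = fun i => s.reg (pos i) :=
            funext fun i => hr _ (hd i)
          have : L - r = (L - (r + 1)) + 1 := by omega
          simp only [Option.elim] at hv
          rw [this, List.range_succ, List.foldl_append, ← h0, ← h2, ← hpos]
          simpa using hv)
    L ((s₁.setReg (d + 1) 0).setReg (d + 2) 1) (by
      refine ⟨le_rfl, fun z hz => ?_, ?_, ?_, ?_, ?_⟩
      · simp [State.setReg_reg, show z ≠ d + 1 by omega, show z ≠ d + 2 by omega,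
          hr₁ z (by omega)]
      · simp [State.setReg_reg, hv₁]
      · simp [State.setReg_reg]
      · simp [State.setReg_reg]
      · simp [hm₁])
  refine ⟨_, s', .seq hx₁ (.seq (.const _ _ _) (.seq (.const _ _ _) hx)),
    ?_, hr', by simpa using hv'⟩
  simp only [Polynomial.eval_add, Polynomial.eval_mul, Polynomial.eval_X, Polynomial.eval_ofNat]
  have : L * (p.eval L + 2 + 1) = L * (p.eval L + 3) := by ring
  omega

/-- Iteration as often as the limit says. -/
theorem iterate {f : (ι → ℕ) → Blocks k → Blocks k} (hf : PCmd i₀ f) :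
    PCmd i₀ fun x m => (f x)^[lim i₀ m] m := by
  have h := forLoop (f := fun x _ m => f x m) (hf.reindex (ι' := Option ι) some)
  simpa [List.foldl_const] using h

theorem lim_iterate {f : (ι → ℕ) → Blocks k → Blocks k} (hf : PCmd i₀ f) (x : ι → ℕ) (n : ℕ)
    (m : Blocks k) : lim i₀ ((f x)^[n] m) = lim i₀ m := by
  induction n generalizing m with
  | zero => rfl
  | succ n ih => rw [Function.iterate_succ_apply, ih, hf.1]

/-- Nesting `t` loops, each running up to the limit, yields the power; every iteration keeps the
limit, so the loops multiply exactly. -/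
theorem iterate_pow {f : (ι → ℕ) → Blocks k → Blocks k} (hf : PCmd i₀ f) (t : ℕ) :
    PCmd i₀ fun x m => (f x)^[lim i₀ m ^ t] m := by
  induction t with
  | zero => simpa using hf
  | succ t ih =>
    have h := ih.iterate
    have key : ∀ x n m, (fun m => (f x)^[lim i₀ m ^ t] m)^[n] m = (f x)^[lim i₀ m ^ t * n] m := by
      intro x n
      induction n with
      | zero => intro m; rfl
      | succ n ihn =>
        intro m
        rw [Function.iterate_succ_apply, ihn, hf.lim_iterate, ← Function.iterate_add_apply,
          Nat.mul_succ]
    simpa only [key, ← pow_succ] using h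

theorem foldl_list {κ : Type*} {f : κ → (ι → ℕ) → Blocks k → Blocks k}
    (hf : ∀ c, PCmd i₀ (f c)) (l : List κ) :
    PCmd i₀ fun x m => l.foldl (fun m c => f c x m) m := by
  induction l with
  | nil => exact skip
  | cons c l ih => exact ih.comp (hf c)

end PCmd

/-- Overwrite the cells below the limit of all arrays of a block. -/
def fill (i₀ : Fin k) (K : ℕ) (e : Fin k → ℕ → Blocks k → ℕ) (m : Blocks k) : Blocks k :=
  Function.update m K fun i p => if p < lim i₀ m then e i p m else m K i p

/-- Since the values do not depend on block `K`, writing the cells in sequence has the effect of a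
simultaneous assignment. -/
theorem foldl_setCell {K : ℕ} (i : Fin k) {e : ℕ → Blocks k → ℕ}
    (he : ∀ p m g, e p (Function.update m K g) = e p m) (r : ℕ) (m : Blocks k) :
    (List.range r).foldl (fun m j => setCell K i j (e j m) m) m =
      Function.update m K (Function.update (m K) i fun p => if p < r then e p m else m K i p) := by
  induction r with
  | zero => simp
  | succ r ih =>
    rw [List.range_succ, List.foldl_append, ih]
    simp only [List.foldl_cons, List.foldl_nil, setCell, he, Function.update_self,
      Function.update_idem]
    congr 2
    funext p
    by_cases hp : p = r
    · subst hp; simp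
    · rw [Function.update_of_ne hp]
      by_cases h : p < r
      · simp [h, h.trans (Nat.lt_succ_self r)]
      · rw [if_neg h, if_neg (by omega)]

theorem fill_of_ne {K K' : ℕ} (h : K' ≠ K) (e : Fin k → ℕ → Blocks k → ℕ) (m : Blocks k) :
    fill i₀ K e m K' = m K' := Function.update_of_ne h _ _

theorem fill_self {K : ℕ} (e : Fin k → ℕ → Blocks k → ℕ) (m : Blocks k) (i : Fin k) {p : ℕ}
    (hp : p < lim i₀ m) : fill i₀ K e m K i p = e i p m := by
  simp [fill, hp]

theorem lim_fill {K : ℕ} (hK : K ≠ 2) (e : Fin k → ℕ → Blocks k → ℕ) (m : Blocks k) :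
    lim i₀ (fill i₀ K e m) = lim i₀ m := lim_update i₀ m hK _

/-- The independence hypothesis `hind` is what makes the order of writing irrelevant. An update of a
block in terms of itself therefore has to go through a scratch block. -/
theorem PCmd.fill {K : ℕ} (hK : K ≠ 2) {e : (ι → ℕ) → Fin k → ℕ → Blocks k → ℕ}
    (hind : ∀ x i p m g, e x i p (Function.update m K g) = e x i p m)
    (he : ∀ i, PExpr i₀ fun (y : Option ι → ℕ) m => e (fun c => y (some c)) i (y none) m) :
    PCmd i₀ fun x m => fill i₀ K (e x) m := by
  have h1 : ∀ i, PCmd i₀ fun x m => Function.update m K (Function.update (m K) i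
      fun p => if p < lim i₀ m then e x i p m else m K i p) := by
    intro i
    have := PCmd.forLoop (f := fun x j m => RAM.setCell K i j (e x i j m) m)
      (PCmd.setCell hK i (PExpr.var none) (he i))
    simpa only [foldl_setCell i (hind _ i)] using this
  have h2 := PCmd.foldl_list h1 (List.finRange k)
  have key : ∀ (x : ι → ℕ) (m : Blocks k) (l : List (Fin k)), l.foldl (fun m i =>
      Function.update m K (Function.update (m K) i
        fun p => if p < lim i₀ m then e x i p m else m K i p)) m =
      Function.update m K fun i p => if i ∈ l ∧ p < lim i₀ m then e x i p m else m K i p := by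
    intro x m l
    induction l generalizing m with
    | nil => simp
    | cons c l ih =>
      rw [List.foldl_cons, ih]
      simp only [lim_update _ _ hK, hind, Function.update_self, Function.update_idem]
      congr 1
      funext i p
      by_cases hi : i = c
      · subst hi
        by_cases hp : p < lim i₀ m <;> simp [hp]
      · simp [hi]
  simp only [key, List.mem_finRange, true_and] at h2
  exact h2

end RAM

/-! Covering the outputs of the edges of a hypergraph by few vertices: an output is covered when
some edge with this output has all its vertices chosen. -/
namespace HyperCover

open Classical in
/-- The edges whose output is not yet covered by the vertices `S`. -/
noncomputable def uncovered {ε V O : Type*} (E : Finset ε) (vs : ε → Finset V) (out : ε → O)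
    (S : Finset V) : Finset ε :=
  E.filter fun e => ¬∃ e' ∈ E, out e' = out e ∧ vs e' ⊆ S

open Classical in
/-- The uncovered edges inside `A`. -/
noncomputable def within {ε V O : Type*} (E : Finset ε) (vs : ε → Finset V) (out : ε → O)
    (S A : Finset V) : Finset ε :=
  (uncovered E vs out S).filter fun e => vs e ⊆ A

open Classical in
/-- The number of uncovered edges inside `A` at the vertex `v`. -/
noncomputable def degree {ε V O : Type*} (E : Finset ε) (vs : ε → Finset V) (out : ε → O)
    (S A : Finset V) (v : V) : ℕ :=
  ((within E vs out S A).filter fun e => v ∈ vs e).card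

open Classical in
/-- Drop the vertices of degree less than `d`. -/
noncomputable def peel {ε V O : Type*} (E : Finset ε) (vs : ε → Finset V) (out : ε → O)
    (d : ℕ) (S A : Finset V) : Finset V :=
  A.filter fun v => d ≤ degree E vs out S A v

open Classical in
/-- The number of outputs that are not covered by `S`. -/
noncomputable def numUncovered {ε V O : Type*} (E : Finset ε) (vs : ε → Finset V) (out : ε → O)
    (S : Finset V) : ℕ :=
  ((uncovered E vs out S).image out).card

open Classical in
/-- If the seed `v` is in the `d`-core, choose all vertices of the core that have its colour. -/
noncomputable def pick {ε V O C : Type*} (E : Finset ε) (vs : ε → Finset V) (out : ε → O)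
    (col : V → C) (A₀ : Finset V) (n d : ℕ) (S : Finset V) (v : V) : Finset V :=
  if v ∈ (peel E vs out d S)^[n] A₀ then
    S ∪ ((peel E vs out d S)^[n] A₀).filter fun w => col w = col v
  else S

/-! ### Cores and degeneracy of the uncovered hypergraph -/

variable {ε V O C : Type*} {E : Finset ε} {vs : ε → Finset V} {out : ε → O} {col : V → C}
  {A₀ S S' A A' : Finset V} {d n b : ℕ}

theorem mem_uncovered {e : ε} : e ∈ uncovered E vs out S ↔
    e ∈ E ∧ ¬∃ e' ∈ E, out e' = out e ∧ vs e' ⊆ S := by simp [uncovered]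

theorem mem_within {e : ε} : e ∈ within E vs out S A ↔ e ∈ uncovered E vs out S ∧ vs e ⊆ A := by
  simp [within]

theorem mem_peel {v : V} : v ∈ peel E vs out d S A ↔ v ∈ A ∧ d ≤ degree E vs out S A v := by
  simp [peel]

theorem mem_pick {v w : V} : w ∈ pick E vs out col A₀ n d S v ↔
    w ∈ S ∨ (v ∈ (peel E vs out d S)^[n] A₀ ∧ w ∈ (peel E vs out d S)^[n] A₀ ∧
      col w = col v) := by
  classical
  unfold pick
  split_ifs with h <;> simp [h]

theorem uncovered_anti (h : S ⊆ S') : uncovered E vs out S' ⊆ uncovered E vs out S := by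
  intro e he
  rw [mem_uncovered] at he ⊢
  exact ⟨he.1, fun ⟨e', h1, h2, h3⟩ => he.2 ⟨e', h1, h2, h3.trans h⟩⟩

theorem within_subset (hS : S ⊆ S') (hA : A ⊆ A') :
    within E vs out S' A ⊆ within E vs out S A' := by
  intro e he
  rw [mem_within] at he ⊢
  exact ⟨uncovered_anti hS he.1, he.2.trans hA⟩

theorem degree_le (hS : S ⊆ S') (hA : A ⊆ A') (v : V) :
    degree E vs out S' A v ≤ degree E vs out S A' v := by
  classical
  exact Finset.card_le_card (Finset.filter_subset_filter _ (within_subset hS hA))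

theorem peel_subset : peel E vs out d S A ⊆ A := Finset.filter_subset _ _

theorem peel_mono (hS : S ⊆ S') (hA : A ⊆ A') : peel E vs out d S' A ⊆ peel E vs out d S A' := by
  intro v hv
  rw [mem_peel] at hv ⊢
  exact ⟨hA hv.1, hv.2.trans (degree_le hS hA v)⟩

/-- Selecting more vertices only shrinks cores, so a vertex that has left the core never returns. -/
theorem core_mono (hS : S ⊆ S') (hA : A ⊆ A') :
    (peel E vs out d S')^[n] A ⊆ (peel E vs out d S)^[n] A' := by
  induction n generalizing A A' with
  | zero => exact hA
  | succ n ih => exact ih (peel_mono hS hA)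

theorem core_subset : (peel E vs out d S)^[n] A ⊆ A := by
  induction n generalizing A with
  | zero => exact subset_rfl
  | succ n ih => exact ih.trans peel_subset

/-- Every peeling that changes the set removes a vertex, so `A.card` rounds reach a fixed point. -/
theorem peel_core (hn : A.card ≤ n) :
    peel E vs out d S ((peel E vs out d S)^[n] A) = (peel E vs out d S)^[n] A := by
  induction n generalizing A with
  | zero =>
    obtain rfl : A = ∅ := Finset.card_eq_zero.1 (Nat.le_zero.1 hn)
    exact Finset.subset_empty.1 peel_subset
  | succ n ih =>
    by_cases h : peel E vs out d S A = A
    · rw [Function.iterate_fixed h, h]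
    · rw [Function.iterate_succ_apply]
      have := Finset.card_lt_card (peel_subset.ssubset_of_ne h)
      exact ih (by omega)

theorem le_degree_core (hn : A.card ≤ n) {v : V} (hv : v ∈ (peel E vs out d S)^[n] A) :
    d ≤ degree E vs out S ((peel E vs out d S)^[n] A) v := by
  rw [← peel_core hn, mem_peel] at hv
  exact hv.2

/-- A set of minimum degree at least `d` is fixed by peeling, and peeling is monotone: the core is
the largest such set. -/
theorem subset_core (hA : A ⊆ A') (h : ∀ v ∈ A, d ≤ degree E vs out S A v) :
    A ⊆ (peel E vs out d S)^[n] A' := by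
  have h1 : peel E vs out d S A = A := Finset.Subset.antisymm peel_subset fun v hv =>
    mem_peel.2 ⟨hv, h v hv⟩
  calc A = (peel E vs out d S)^[n] A := (Function.iterate_fixed h1 n).symm
    _ ⊆ _ := core_mono subset_rfl hA

/-- Every nonempty set of vertices has a vertex of degree at most `d` in it. -/
def Thin (E : Finset ε) (vs : ε → Finset V) (out : ε → O) (A₀ S : Finset V) (d : ℕ) : Prop :=
  ∀ A ⊆ A₀, A.Nonempty → ∃ v ∈ A, degree E vs out S A v ≤ d

theorem Thin.mono (h : Thin E vs out A₀ S d) (hS : S ⊆ S') : Thin E vs out A₀ S' d := by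
  intro A hA hne
  obtain ⟨v, hv, hd⟩ := h A hA hne
  exact ⟨v, hv, (degree_le hS subset_rfl v).trans hd⟩

theorem thin_card : Thin E vs out A₀ S E.card := by
  intro A _ hne
  obtain ⟨v, hv⟩ := hne
  refine ⟨v, hv, Finset.card_le_card fun e he => ?_⟩
  simp only [Finset.mem_filter, mem_within, mem_uncovered] at he
  exact he.1.1.1

theorem thin_of_core_eq_empty (h : (peel E vs out (d + 1) S)^[n] A₀ = ∅) :
    Thin E vs out A₀ S d := by
  intro A hA hne
  by_contra! hcon
  have := subset_core (n := n) hA fun v hv => hcon v hv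
  rw [h, Finset.subset_empty] at this
  exact hne.ne_empty this

/-- The usual edge bound for degenerate hypergraphs: remove a vertex of degree at most `d`, losing
at most `d` edges, and induct. Edges must be nonempty so that none survives in the empty set. -/
theorem Thin.card_within_le (h : Thin E vs out A₀ S d) (hne : ∀ e ∈ E, (vs e).Nonempty)
    (hA : A ⊆ A₀) : (within E vs out S A).card ≤ d * A.card := by
  classical
  induction A using Finset.strongInduction with
  | H A ih =>
    rcases A.eq_empty_or_nonempty with rfl | hA'
    · have : within E vs out S ∅ = ∅ := by
        refine Finset.eq_empty_of_forall_notMem fun e he => ?_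
        rw [mem_within, mem_uncovered] at he
        exact (hne e he.1.1).ne_empty (Finset.subset_empty.1 he.2)
      simp [this]
    · obtain ⟨v, hv, hd⟩ := h A hA hA'
      have h1 := ih (A.erase v) (Finset.erase_ssubset hv) ((Finset.erase_subset v A).trans hA)
      have h2 : within E vs out S A ⊆ within E vs out S (A.erase v) ∪
          (within E vs out S A).filter fun e => v ∈ vs e := by
        intro e he
        rw [Finset.mem_union, Finset.mem_filter]
        by_cases hve : v ∈ vs e
        · exact .inr ⟨he, hve⟩
        · rw [mem_within] at he
          exact .inl (mem_within.2 ⟨he.1, Finset.subset_erase.2 ⟨he.2, hve⟩⟩)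
      have h3 := (Finset.card_le_card h2).trans (Finset.card_union_le _ _)
      rw [Finset.card_erase_of_mem hv] at h1
      have h4 : A.card = (A.card - 1) + 1 := by have := hA'.card_pos; omega
      rw [degree] at hd
      rw [h4, mul_add_one]
      omega

/-- The vertices `S` cover all outputs. -/
def Feasible (E : Finset ε) (vs : ε → Finset V) (out : ε → O) (S : Finset V) : Prop :=
  ∀ e ∈ E, ∃ e' ∈ E, out e' = out e ∧ vs e' ⊆ S

/-- This is the lower bound on the optimum. For each uncovered output, `R` contains all vertices of
some edge with that output, and this edge is itself uncovered; degeneracy bounds the number of edges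
inside `R`. -/
theorem Thin.numUncovered_le (h : Thin E vs out A₀ S d) (hne : ∀ e ∈ E, (vs e).Nonempty)
    {R : Finset V} (hR : R ⊆ A₀) (hf : Feasible E vs out R) :
    numUncovered E vs out S ≤ d * R.card := by
  classical
  refine le_trans ?_ (h.card_within_le hne hR)
  refine le_trans (Finset.card_le_card fun o ho => ?_)
    (Finset.card_image_le (f := out) (s := within E vs out S R))
  obtain ⟨e, he, rfl⟩ := Finset.mem_image.1 ho
  rw [mem_uncovered] at he
  obtain ⟨e', he', ho', hR'⟩ := hf e he.1
  refine Finset.mem_image.2 ⟨e', mem_within.2 ⟨mem_uncovered.2 ⟨he', ?_⟩, hR'⟩, ho'⟩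
  rw [ho']
  exact he.2

theorem feasible_of_thin_zero (h : Thin E vs out A₀ S 0) (hne : ∀ e ∈ E, (vs e).Nonempty)
    (hvs : ∀ e ∈ E, vs e ⊆ A₀) : Feasible E vs out S := by
  intro e he
  by_contra hcon
  have h1 := h.card_within_le hne (hvs e he)
  rw [zero_mul, Nat.le_zero, Finset.card_eq_zero] at h1
  have : e ∈ within E vs out S (vs e) := mem_within.2 ⟨mem_uncovered.2 ⟨he, hcon⟩, subset_rfl⟩
  simp [h1] at this

/-- Count incidences between `P` and the uncovered edges inside it: there are at least `d` per
vertex and at most `b` per edge. By `hinj` these edges have distinct outputs, all of which become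
covered. -/
theorem numUncovered_union_le [DecidableEq V] {P : Finset V}
    (hdeg : ∀ v ∈ P, d ≤ degree E vs out S P v) (hb : ∀ e ∈ E, (vs e).card ≤ b)
    (hinj : ∀ e ∈ E, ∀ e' ∈ E, vs e ⊆ P → vs e' ⊆ P → out e = out e' → e = e') :
    P.card * d + numUncovered E vs out (S ∪ P) * b ≤ numUncovered E vs out S * b := by
  classical
  have h1 : P.card * d ≤ (within E vs out S P).card * b := by
    refine Finset.card_mul_le_card_mul (fun v e => v ∈ vs e) (fun v hv =>
      (hdeg v hv).trans_eq (by rw [degree, Finset.bipartiteAbove]; congr!))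
      fun e he => ?_
    rw [mem_within, mem_uncovered] at he
    exact le_trans (Finset.card_le_card fun v hv => (Finset.mem_bipartiteBelow _).1 hv |>.2)
      (hb e he.1.1)
  have h2 : (within E vs out S P).card + numUncovered E vs out (S ∪ P) ≤
      numUncovered E vs out S := by
    rw [← Finset.card_image_of_injOn (f := out) (s := within E vs out S P), numUncovered,
      numUncovered, ← Finset.card_union_of_disjoint]
    · refine Finset.card_le_card (Finset.union_subset (Finset.image_subset_image
        fun e he => (mem_within.1 he).1) (Finset.image_subset_image
        (uncovered_anti Finset.subset_union_left)))
    · rw [Finset.disjoint_left]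
      intro o ho ho'
      obtain ⟨e, he, rfl⟩ := Finset.mem_image.1 ho
      obtain ⟨e', he', heq⟩ := Finset.mem_image.1 ho'
      rw [mem_within, mem_uncovered] at he
      rw [mem_uncovered] at he'
      exact he'.2 ⟨e, he.1.1, heq.symm, he.2.trans Finset.subset_union_right⟩
    · intro e he e' he' heq
      rw [Finset.mem_coe, mem_within, mem_uncovered] at he he'
      exact hinj e he.1.1 e' he'.1.1 he.2 he'.2 heq
  calc _ ≤ (within E vs out S P).card * b + numUncovered E vs out (S ∪ P) * b := by gcongr
    _ = ((within E vs out S P).card + numUncovered E vs out (S ∪ P)) * b := by ring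
    _ ≤ _ := by gcongr

/-! ### The harmonic potential and the greedy invariant -/

/-- The right-hand side is a sum of `u - u'` reciprocals, each at least `1 / u`. -/
theorem sub_div_le_harmonic_sub {u u' : ℕ} (h : u' ≤ u) :
    ((u : ℚ) - u') / u ≤ harmonic u - harmonic u' := by
  induction u, h using Nat.le_induction with
  | base => simp
  | succ u hu ih =>
    rw [harmonic_succ]
    rcases Nat.eq_zero_or_pos u with rfl | hpos
    · obtain rfl : u' = 0 := Nat.le_zero.1 hu
      simp
    · have h1 : (0 : ℚ) < u := by exact_mod_cast hpos
      have h2 : (u' : ℚ) ≤ u := by exact_mod_cast hu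
      have h3 : ((u : ℚ) - u') / (u + 1) ≤ (u - u') / u :=
        div_le_div_of_nonneg_left (by linarith) h1 (by linarith)
      have h4 : (((u + 1 : ℕ) : ℚ) - u') / ((u + 1 : ℕ) : ℚ) =
          (u - u') / (u + 1) + ((u + 1 : ℕ) : ℚ)⁻¹ := by
        push_cast
        field_simp
        ring
      rw [h4]
      linarith

/-- The potential of the greedy algorithm with respect to a solution of size `r`. -/
noncomputable def potential (E : Finset ε) (vs : ε → Finset V) (out : ε → O) (b r : ℕ)
    (S : Finset V) : ℚ :=
  S.card + b * r * harmonic (numUncovered E vs out S)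

/-- The hypothesis `hr` turns the price `b / d` per newly covered output into `b * r / u`, which the
drop of the harmonic term pays for. -/
theorem potential_union_le [DecidableEq V] {P : Finset V} {r : ℕ} (hd : 0 < d)
    (hdeg : ∀ v ∈ P, d ≤ degree E vs out S P v) (hb : ∀ e ∈ E, (vs e).card ≤ b)
    (hinj : ∀ e ∈ E, ∀ e' ∈ E, vs e ⊆ P → vs e' ⊆ P → out e = out e' → e = e')
    (hr : numUncovered E vs out S ≤ d * r) :
    potential E vs out b r (S ∪ P) ≤ potential E vs out b r S := by
  have h1 := numUncovered_union_le hdeg hb hinj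
  have hu : numUncovered E vs out (S ∪ P) ≤ numUncovered E vs out S := by
    classical
    exact Finset.card_le_card (Finset.image_subset_image (uncovered_anti Finset.subset_union_left))
  have h2 := sub_div_le_harmonic_sub hu
  unfold potential
  generalize numUncovered E vs out S = u at *
  generalize numUncovered E vs out (S ∪ P) = u' at *
  have hcard : ((S ∪ P).card : ℚ) ≤ S.card + P.card := by exact_mod_cast Finset.card_union_le S P
  have h1' : (P.card : ℚ) * d + u' * b ≤ u * b := by exact_mod_cast h1
  have hr' : (u : ℚ) ≤ d * r := by exact_mod_cast hr
  have hd' : (0 : ℚ) < d := by exact_mod_cast hd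
  have hP : (P.card : ℚ) ≤ b * r * ((u - u') / u) := by
    rcases Nat.eq_zero_or_pos u with rfl | hpos
    · have : P.card * d = 0 := by omega
      have : P.card = 0 := by simpa [hd.ne'] using this
      simp [this]
    · have hpos' : (0 : ℚ) < u := by exact_mod_cast hpos
      rw [← mul_div_assoc, le_div_iff₀ hpos']
      calc (P.card : ℚ) * u ≤ P.card * (d * r) := by gcongr
        _ = (P.card * d) * r := by ring
        _ ≤ (u * b - u' * b) * r := by gcongr; linarith
        _ = _ := by ring
  have h3 : (b : ℚ) * r * ((u - u') / u) ≤ b * r * (harmonic u - harmonic u') := by gcongr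
  linarith

/-- The hypotheses on the hypergraph: the vertices of an edge have a common colour, and an edge is
determined by its colour and its output; every edge has between one and `b` vertices. -/
structure Colored (E : Finset ε) (vs : ε → Finset V) (out : ε → O) (col : V → C)
    (A₀ : Finset V) (b : ℕ) : Prop where
  nonempty : ∀ e ∈ E, (vs e).Nonempty
  subset : ∀ e ∈ E, vs e ⊆ A₀
  card_le : ∀ e ∈ E, (vs e).card ≤ b
  col_eq : ∀ e ∈ E, ∀ v ∈ vs e, ∀ w ∈ vs e, col v = col w
  inj : ∀ e ∈ E, ∀ e' ∈ E, ∀ v ∈ vs e, ∀ w ∈ vs e', col v = col w → out e = out e' → e = e'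

theorem subset_pick {v : V} : S ⊆ pick E vs out col A₀ n d S v := by
  classical
  unfold pick
  split_ifs
  · exact Finset.subset_union_left
  · exact subset_rfl

theorem subset_foldl_pick (l : List V) : S ⊆ l.foldl (pick E vs out col A₀ n d) S := by
  induction l generalizing S with
  | nil => exact subset_rfl
  | cons v l ih => exact subset_pick.trans ih

theorem pick_subset {v : V} (hS : S ⊆ A₀) : pick E vs out col A₀ n d S v ⊆ A₀ := by
  classical
  unfold pick
  split_ifs
  · exact Finset.union_subset hS ((Finset.filter_subset _ _).trans core_subset)
  · exact hS

/-- If the seed survived, an uncovered edge through it would lie inside the new core, hence inside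
the old one. Having the seed's colour, all its vertices were just selected, so the edge is covered.
-/
theorem Colored.notMem_core_pick (h : Colored E vs out col A₀ b) (hd : 0 < d)
    (hn : A₀.card ≤ n) {v : V} :
    v ∉ (peel E vs out d (pick E vs out col A₀ n d S v))^[n] A₀ := by
  classical
  intro hv
  have hv' : v ∈ (peel E vs out d S)^[n] A₀ := core_mono subset_pick subset_rfl hv
  obtain ⟨e, he⟩ := Finset.card_pos.1 (hd.trans_le (le_degree_core hn hv))
  rw [Finset.mem_filter, mem_within, mem_uncovered] at he
  obtain ⟨⟨⟨heE, hcov⟩, hsub⟩, hve⟩ := he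
  refine hcov ⟨e, heE, rfl, fun w hw => ?_⟩
  rw [pick, if_pos hv']
  exact Finset.mem_union_right _ (Finset.mem_filter.2
    ⟨core_mono subset_pick subset_rfl (hsub hw), h.col_eq e heE w hw v hve⟩)

/-- Edges are monochromatic, so restricting the core to the colour of the seed keeps the degrees of
the remaining vertices. Within one colour, the output determines the edge. -/
theorem Colored.potential_pick_le (h : Colored E vs out col A₀ b) (hd : 0 < d)
    (hn : A₀.card ≤ n) {v : V} {r : ℕ} (hr : numUncovered E vs out S ≤ d * r) :
    potential E vs out b r (pick E vs out col A₀ n d S v) ≤ potential E vs out b r S := by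
  classical
  by_cases hv : v ∈ (peel E vs out d S)^[n] A₀
  · rw [pick, if_pos hv]
    refine potential_union_le hd (fun w hw => ?_) h.card_le ?_ hr
    · rw [Finset.mem_filter] at hw
      refine (le_degree_core hn hw.1).trans (Finset.card_le_card fun e he => ?_)
      rw [Finset.mem_filter, mem_within] at he ⊢
      refine ⟨⟨he.1.1, fun z hz => Finset.mem_filter.2 ⟨he.1.2 hz, ?_⟩⟩, he.2⟩
      rw [← hw.2]
      exact h.col_eq e (mem_uncovered.1 he.1.1).1 z hz w he.2
    · intro e he e' he' hP hP' ho
      obtain ⟨w, hw⟩ := h.nonempty e he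
      obtain ⟨w', hw'⟩ := h.nonempty e' he'
      refine h.inj e he e' he' w hw w' hw' ?_ ho
      rw [(Finset.mem_filter.1 (hP hw)).2, (Finset.mem_filter.1 (hP' hw')).2]
  · rw [pick, if_neg hv]

/-- The invariant of the greedy algorithm. -/
structure Inv (E : Finset ε) (vs : ε → Finset V) (out : ε → O) (A₀ : Finset V) (b d : ℕ)
    (S : Finset V) : Prop where
  thin : Thin E vs out A₀ S d
  subset : S ⊆ A₀
  potential_le : ∀ R ⊆ A₀, Feasible E vs out R →
    potential E vs out b R.card S ≤ potential E vs out b R.card ∅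

theorem inv_empty (hd : E.card ≤ d) : Inv E vs out A₀ b d ∅ where
  thin A hA hne := by
    obtain ⟨v, hv, h⟩ := thin_card (E := E) (vs := vs) (out := out) (S := ∅) A hA hne
    exact ⟨v, hv, h.trans hd⟩
  subset := Finset.empty_subset _
  potential_le _ _ _ := le_rfl

theorem Inv.pick (h : Colored E vs out col A₀ b) (hd : 0 < d) (hn : A₀.card ≤ n)
    (hi : Inv E vs out A₀ b d S) (v : V) :
    Inv E vs out A₀ b d (pick E vs out col A₀ n d S v) where
  thin := hi.thin.mono subset_pick
  subset := pick_subset hi.subset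
  potential_le R hR hf :=
    (h.potential_pick_le hd hn (hi.thin.numUncovered_le h.nonempty hR hf)).trans
      (hi.potential_le R hR hf)

/-- One pass over seeds that meet every edge suffices: a nonempty core contains an edge, hence a
seed, but each seed left the core when it was processed. The empty `(d + 1)`-core then gives
degeneracy `d`. -/
theorem Inv.round (h : Colored E vs out col A₀ b) (hn : A₀.card ≤ n)
    (hi : Inv E vs out A₀ b (d + 1) S) (l : List V) (hl : ∀ e ∈ E, ∃ v ∈ l, v ∈ vs e) :
    Inv E vs out A₀ b d (l.foldl (HyperCover.pick E vs out col A₀ n (d + 1)) S) := by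
  classical
  have h1 : ∀ (l : List V) S, Inv E vs out A₀ b (d + 1) S →
      Inv E vs out A₀ b (d + 1) (l.foldl (HyperCover.pick E vs out col A₀ n (d + 1)) S) := by
    intro l
    induction l with
    | nil => exact fun S h => h
    | cons v l ih => exact fun S hS => ih _ (hS.pick h d.succ_pos hn v)
  refine ⟨thin_of_core_eq_empty (n := n) ?_, (h1 l S hi).subset, (h1 l S hi).potential_le⟩
  refine Finset.eq_empty_of_forall_notMem fun w hw => ?_
  obtain ⟨e, he⟩ := Finset.card_pos.1 (d.succ_pos.trans_le (le_degree_core hn hw))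
  rw [Finset.mem_filter, mem_within, mem_uncovered] at he
  obtain ⟨⟨⟨heE, -⟩, hsub⟩, -⟩ := he
  obtain ⟨v, hvl, hve⟩ := hl e heE
  -- Split the pass at the seed `v`: processing `v` expels it, and the later picks only shrink the
  -- core.
  obtain ⟨l₁, l₂, rfl⟩ := List.append_of_mem hvl
  have hv := hsub hve
  rw [List.foldl_append, List.foldl_cons] at hv
  exact h.notMem_core_pick d.succ_pos hn (core_mono (subset_foldl_pick l₂) subset_rfl hv)

theorem Inv.feasible (h : Colored E vs out col A₀ b) (hi : Inv E vs out A₀ b 0 S) :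
    Feasible E vs out S :=
  feasible_of_thin_zero hi.thin h.nonempty h.subset

theorem Inv.card_le (hi : Inv E vs out A₀ b d S) {R : Finset V} (hR : R ⊆ A₀)
    (hf : Feasible E vs out R) : (S.card : ℝ) ≤ b * (1 + Real.log E.card) * R.card := by
  classical
  have h1 := hi.potential_le R hR hf
  have hH : (0 : ℚ) ≤ harmonic (numUncovered E vs out S) := by
    rw [harmonic]
    positivity
  have h2 : (S.card : ℚ) ≤ b * R.card * harmonic (numUncovered E vs out ∅) := by
    have : (0 : ℚ) ≤ b * R.card * harmonic (numUncovered E vs out S) := by positivity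
    simp only [potential, Finset.card_empty, Nat.cast_zero, zero_add] at h1
    linarith
  have h3 : (S.card : ℝ) ≤ b * R.card * (harmonic (numUncovered E vs out ∅) : ℝ) := by
    exact_mod_cast h2
  have hu : numUncovered E vs out ∅ ≤ E.card :=
    Finset.card_image_le.trans (Finset.card_le_card (Finset.filter_subset _ _))
  have h4 : (harmonic (numUncovered E vs out ∅) : ℝ) ≤ 1 + Real.log E.card := by
    refine (harmonic_le_one_add_log _).trans ?_
    rcases Nat.eq_zero_or_pos (numUncovered E vs out ∅) with h0 | hpos
    · rw [h0]
      have := Real.log_natCast_nonneg E.card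
      simpa using this
    · gcongr
  calc (S.card : ℝ) ≤ b * R.card * (1 + Real.log E.card) := h3.trans (by gcongr)
    _ = _ := by ring

end HyperCover

/-! ### The algorithm as a memory transformation -/

namespace CQ

open RAM

/-- The position of an attribute in the rows of a table. -/
noncomputable def position (X : Finset ℕ) (a : ℕ) : ℕ :=
  if h : a ∈ X then ((X.orderIsoOfFin rfl).symm ⟨a, h⟩ : Fin X.card) else 0

/-- The value at attribute `a` of row `j` of table `i`, as stored in the memory. -/
noncomputable def value (Q : CQ) (m : Blocks Q.numRels) (i : Fin Q.numRels) (j a : ℕ) : ℕ :=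
  m 0 i (j * (Q.attr i).card + position (Q.attr i) a)

/-- The rows `J i` of the tables in the memory are joinable. -/
def IsEdge (Q : CQ) (m : Blocks Q.numRels) (J : Fin Q.numRels → ℕ) : Prop :=
  (∀ i, J i < m 1 i 0) ∧
    ∀ i i', ∀ a ∈ Q.attr i ∩ Q.attr i', Q.value m i (J i) a = Q.value m i' (J i') a

/-- Two choices of rows agree on the output attributes. -/
def SameOutput (Q : CQ) (m : Blocks Q.numRels) (J J' : Fin Q.numRels → ℕ) : Prop :=
  ∀ i, ∀ a ∈ Q.attr i ∩ Q.head, Q.value m i (J i) a = Q.value m i (J' i) a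

/-- The output of the rows `J` is covered by the rows selected in block `4`. -/
def IsCovered (Q : CQ) (β : ℕ) (i₀ : Fin Q.numRels) (m : Blocks Q.numRels)
    (J : Fin Q.numRels → ℕ) : Prop :=
  ∃ J' : Fin Q.numRels → ℕ, (∀ c, J' c < lim i₀ m) ∧
    Q.IsEdge m J' ∧ Q.SameOutput m J' J ∧ ∀ i, β ∈ Q.attr i → m 4 i (J' i) ≠ 0

open Classical in
/-- The number of uncovered edges through row `p` of table `i` inside block `5`. -/
noncomputable def rowDegree (Q : CQ) (β : ℕ) (i₀ : Fin Q.numRels) (m : Blocks Q.numRels)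
    (i : Fin Q.numRels) (p : ℕ) : ℕ :=
  ∑ J ∈ Fintype.piFinset fun _ : Fin Q.numRels => Finset.range (lim i₀ m),
    if J i = p ∧ Q.IsEdge m J ∧ (∀ i', β ∈ Q.attr i' → m 5 i' (J i') ≠ 0) ∧
      ¬Q.IsCovered β i₀ m J then 1 else 0

/-- Put all rows with the attribute `β` into block `5`. -/
def startCmd (Q : CQ) (β : ℕ) (i₀ : Fin Q.numRels) (m : Blocks Q.numRels) : Blocks Q.numRels :=
  fill i₀ 5 (fun i p m => if β ∈ Q.attr i ∧ p < m 1 i 0 then 1 else 0) m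

/-- Drop the rows of small degree from block `5`. -/
noncomputable def peelCmd (Q : CQ) (β : ℕ) (i₀ : Fin Q.numRels) (m : Blocks Q.numRels) :
    Blocks Q.numRels :=
  fill i₀ 5 (fun i p m => m 6 i p)
    (fill i₀ 6 (fun i p m => if m 5 i p ≠ 0 ∧ m 3 i₀ 0 ≤ Q.rowDegree β i₀ m i p then 1 else 0) m)

/-- Compute the core and select its rows with the `β`-value of row `j` of table `i₀`, if this row
belongs to the core. -/
noncomputable def pickCmd (Q : CQ) (β : ℕ) (i₀ : Fin Q.numRels) (j : ℕ)
    (m : Blocks Q.numRels) : Blocks Q.numRels :=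
  fill i₀ 4 (fun i p m => m 6 i p)
    (fill i₀ 6 (fun i p m => if m 4 i p ≠ 0 ∨ (m 5 i₀ j ≠ 0 ∧ m 5 i p ≠ 0 ∧
        Q.value m i p β = Q.value m i₀ j β) then 1 else 0)
      ((Q.peelCmd β i₀)^[lim i₀ (Q.startCmd β i₀ m)] (Q.startCmd β i₀ m)))

/-- One round of the greedy algorithm, after which the threshold in block `3` is decreased. -/
noncomputable def roundCmd (Q : CQ) (β : ℕ) (i₀ : Fin Q.numRels) (m : Blocks Q.numRels) :
    Blocks Q.numRels :=
  fill i₀ 3 (fun i p m => m 6 i p) (fill i₀ 6 (fun i p m => m 3 i p - 1)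
    ((List.range (lim i₀ m)).foldl (fun m j => Q.pickCmd β i₀ j m) m))

/-- Set the threshold in block `3` to the number of all choices of indices below the limit. -/
def initCmd (Q : CQ) (i₀ : Fin Q.numRels) (m : Blocks Q.numRels) : Blocks Q.numRels :=
  fill i₀ 3 (fun _ _ m =>
    ∑ _J ∈ Fintype.piFinset fun _ : Fin Q.numRels => Finset.range (lim i₀ m), 1) m

/-- The greedy algorithm. -/
noncomputable def greedyCmd (Q : CQ) (β : ℕ) (i₀ : Fin Q.numRels) (m : Blocks Q.numRels) :
    Blocks Q.numRels :=
  (Q.roundCmd β i₀)^[lim i₀ (Q.initCmd i₀ m) ^ Q.numRels] (Q.initCmd i₀ m)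

open Classical in
/-- Mark the rows of the solution in block `7`. -/
noncomputable def markCmd (Q : CQ) (β : ℕ) (i₀ : Fin Q.numRels) (m : Blocks Q.numRels) :
    Blocks Q.numRels :=
  fill i₀ 7 (fun i p m => if p < m 1 i 0 ∧ ((β ∈ Q.attr i ∧ m 4 i p ≠ 0) ∨
    (β ∉ Q.attr i ∧ ∃ J : Fin Q.numRels → ℕ, (∀ c, J c < lim i₀ m) ∧
      Q.IsEdge m J ∧ J i = p)) then 1 else 0) m

/-- The number of marked rows before row `j`. -/
def rank (Q : CQ) (i₀ : Fin Q.numRels) (m : Blocks Q.numRels) (i : Fin Q.numRels) (j : ℕ) : ℕ :=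
  ∑ j' ∈ Finset.range (lim i₀ m), if j' < j ∧ m 7 i j' ≠ 0 then 1 else 0

/-- Write the marked rows one after the other into block `8`, and their numbers into block `9`;
then move block `8` to block `0`. -/
def outputCmd (Q : CQ) (i₀ : Fin Q.numRels) (m : Blocks Q.numRels) : Blocks Q.numRels :=
  fill i₀ 0 (fun i p m => m 8 i p)
    (fill i₀ 9 (fun i _ m => ∑ j ∈ Finset.range (lim i₀ m), if m 7 i j ≠ 0 then 1 else 0)
      (fill i₀ 8 (fun i p m => ∑ j ∈ Finset.range (lim i₀ m), if m 7 i j ≠ 0 then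
        ∑ c ∈ Finset.range (Q.attr i).card,
          if Q.rank i₀ m i j * (Q.attr i).card + c = p then
            m 0 i (j * (Q.attr i).card + c) else 0 else 0) m))

/-- The whole algorithm on the memory. -/
noncomputable def solveCmd (Q : CQ) (β : ℕ) (i₀ : Fin Q.numRels) (m : Blocks Q.numRels) :
    Blocks Q.numRels :=
  Q.outputCmd i₀ (Q.markCmd β i₀ (Q.greedyCmd β i₀ m))

/-! ### Polynomial-time computability of the algorithm -/

section Computable

variable {Q : CQ} {β : ℕ} {i₀ : Fin Q.numRels} {ι : Type}

theorem pexpr_value (i : Fin Q.numRels) {e : (ι → ℕ) → Blocks Q.numRels → ℕ}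
    (he : PExpr i₀ e) (a : ℕ) : PExpr i₀ fun x m => Q.value m i (e x m) a :=
  .read 0 i ((he.mul_const _).add (.const _))

theorem ppred_isEdge {J : Fin Q.numRels → (ι → ℕ) → Blocks Q.numRels → ℕ}
    (hJ : ∀ c, PExpr i₀ (J c)) : PPred i₀ fun x m => Q.IsEdge m fun c => J c x m :=
  .and (.forall_fintype fun c => .lt (hJ c) (.read 1 c (.const 0)))
    (.forall_fintype fun i => .forall_fintype fun i' => .forall_finset _ fun a _ =>
      .eq (pexpr_value i (hJ i) a) (pexpr_value i' (hJ i') a))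

theorem ppred_sameOutput {J J' : Fin Q.numRels → (ι → ℕ) → Blocks Q.numRels → ℕ}
    (hJ : ∀ c, PExpr i₀ (J c)) (hJ' : ∀ c, PExpr i₀ (J' c)) :
    PPred i₀ fun x m => Q.SameOutput m (fun c => J c x m) fun c => J' c x m :=
  .forall_fintype fun i => .forall_finset _ fun a _ =>
    .eq (pexpr_value i (hJ i) a) (pexpr_value i (hJ' i) a)

theorem ppred_rows (K : ℕ) {J : Fin Q.numRels → (ι → ℕ) → Blocks Q.numRels → ℕ}
    (hJ : ∀ c, PExpr i₀ (J c)) :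
    PPred i₀ fun x m => ∀ i, β ∈ Q.attr i → m K i (J i x m) ≠ 0 :=
  .forall_fintype fun i => ((PPred.const (β ∉ Q.attr i)).or
    (PPred.eq (.read K i (hJ i)) (.const 0)).not).congr fun _ _ => imp_iff_not_or

theorem ppred_isCovered {J : Fin Q.numRels → (ι → ℕ) → Blocks Q.numRels → ℕ}
    (hJ : ∀ c, PExpr i₀ (J c)) : PPred i₀ fun x m => Q.IsCovered β i₀ m fun c => J c x m :=
  .exists_pi (p := fun x J' m => Q.IsEdge m J' ∧ Q.SameOutput m J' (fun c => J c x m) ∧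
      ∀ i, β ∈ Q.attr i → m 4 i (J' i) ≠ 0)
    ((ppred_isEdge fun c => .var (Sum.inr c)).and
      ((ppred_sameOutput (fun c => .var (Sum.inr c)) fun c => (hJ c).reindex Sum.inl).and
        (ppred_rows 4 fun c => .var (Sum.inr c))))

theorem pexpr_rowDegree (i : Fin Q.numRels) {e : (ι → ℕ) → Blocks Q.numRels → ℕ}
    (he : PExpr i₀ e) : PExpr i₀ fun x m => Q.rowDegree β i₀ m i (e x m) := by
  classical
  exact .sum_pi (e := fun x J m => if J i = e x m ∧ Q.IsEdge m J ∧
      (∀ i', β ∈ Q.attr i' → m 5 i' (J i') ≠ 0) ∧ ¬Q.IsCovered β i₀ m J then 1 else 0)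
    (.ite (.and (.eq (.var (Sum.inr i)) (he.reindex Sum.inl))
      (.and (ppred_isEdge fun c => .var (Sum.inr c)) (.and (ppred_rows 5 fun c => .var (Sum.inr c))
        (.not (ppred_isCovered fun c => .var (Sum.inr c)))))) (.const 1) (.const 0))

theorem isEdge_congr {m m' : Blocks Q.numRels} (h0 : m 0 = m' 0) (h1 : m 1 = m' 1) :
    Q.IsEdge m = Q.IsEdge m' := by
  funext J; simp only [IsEdge, value, h0, h1]

theorem sameOutput_congr {m m' : Blocks Q.numRels} (h0 : m 0 = m' 0) :
    Q.SameOutput m = Q.SameOutput m' := by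
  funext J J'; simp only [SameOutput, value, h0]

/-- Degrees read only blocks up to 5, so the peeled set can be assembled in scratch block 6 while
block 5 stays intact. -/
theorem rowDegree_update {K : ℕ} (hK : 5 < K) (m : Blocks Q.numRels)
    (g : Fin Q.numRels → ℕ → ℕ) :
    Q.rowDegree β i₀ (Function.update m K g) = Q.rowDegree β i₀ m := by
  classical
  have h : ∀ c ≤ 5, Function.update m K g c = m c := fun c hc =>
    Function.update_of_ne (by omega) _ _
  funext i p
  have hc : Q.IsCovered β i₀ (Function.update m K g) = Q.IsCovered β i₀ m := by
    funext J
    simp only [IsCovered, isEdge_congr (h 0 (by omega)) (h 1 (by omega)),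
      sameOutput_congr (h 0 (by omega)), h 4 (by omega), lim_update i₀ m (show K ≠ 2 by omega)]
  rw [rowDegree, rowDegree, lim_update i₀ m (show K ≠ 2 by omega)]
  refine Finset.sum_congr rfl fun J _ => if_congr ?_ rfl rfl
  rw [isEdge_congr (h 0 (by omega)) (h 1 (by omega)), hc, h 5 (by omega)]

theorem pcmd_copy {K K' : ℕ} (hK : K ≠ 2) (h : K' ≠ K) :
    PCmd i₀ fun (_ : ι → ℕ) m => fill i₀ K (fun i p m => m K' i p) m :=
  .fill hK (fun _ i p m g => by rw [Function.update_of_ne h]) fun i => .read K' i (PExpr.var none)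

theorem pcmd_startCmd : PCmd i₀ fun (_ : ι → ℕ) m => Q.startCmd β i₀ m := by
  refine .fill (by omega) (fun _ i p m g => by rw [Function.update_of_ne (by omega)]) fun i => ?_
  exact .ite ((PPred.const _).and (.lt (PExpr.var none) (.read 1 i (.const 0)))) (.const 1) (.const 0)

theorem pcmd_peelCmd : PCmd i₀ fun (_ : ι → ℕ) m => Q.peelCmd β i₀ m := by
  refine (pcmd_copy (by omega) (by omega)).comp (.fill (by omega) (fun _ i p m g => ?_)
    fun i => ?_)
  · rw [Function.update_of_ne (by omega), Function.update_of_ne (by omega),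
      rowDegree_update (by omega)]
  · exact .ite ((PPred.eq (.read 5 i (PExpr.var none)) (.const 0)).not.and
      (.le (.read 3 i₀ (.const 0)) (pexpr_rowDegree i (PExpr.var none)))) (.const 1) (.const 0)

theorem pcmd_pickCmd (j : ι) : PCmd i₀ fun (x : ι → ℕ) m => Q.pickCmd β i₀ (x j) m := by
  refine (pcmd_copy (by omega) (by omega)).comp (PCmd.comp (.fill (by omega)
    (e := fun x i p m => if m 4 i p ≠ 0 ∨ (m 5 i₀ (x j) ≠ 0 ∧ m 5 i p ≠ 0 ∧
        Q.value m i p β = Q.value m i₀ (x j) β) then 1 else 0)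
    (fun x i p m g => ?_) fun i => ?_) (pcmd_peelCmd.iterate.comp pcmd_startCmd))
  · simp only [value, Function.update_of_ne (show 4 ≠ 6 by omega),
      Function.update_of_ne (show 5 ≠ 6 by omega), Function.update_of_ne (show 0 ≠ 6 by omega)]
    congr!
  · exact .ite ((PPred.eq (.read 4 i (PExpr.var none)) (.const 0)).not.or
      ((PPred.eq (.read 5 i₀ (.var (some j))) (.const 0)).not.and
        ((PPred.eq (.read 5 i (PExpr.var none)) (.const 0)).not.and
          (.eq (pexpr_value i (PExpr.var none) β) (pexpr_value i₀ (.var (some j)) β)))))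
      (.const 1) (.const 0)

theorem pcmd_roundCmd : PCmd i₀ fun (_ : ι → ℕ) m => Q.roundCmd β i₀ m := by
  refine (pcmd_copy (by omega) (by omega)).comp (PCmd.comp (.fill (by omega)
    (fun _ i p m g => by rw [Function.update_of_ne (by omega)]) fun i => ?_)
    (.forLoop (f := fun _ j m => Q.pickCmd β i₀ j m) (pcmd_pickCmd none)))
  exact .sub (.read 3 i (PExpr.var none)) (.const 1)

theorem pcmd_initCmd : PCmd i₀ fun (_ : ι → ℕ) m => Q.initCmd i₀ m := by
  refine .fill (by omega) (fun _ i p m g => by rw [lim_update i₀ m (by omega)]) fun i => ?_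
  exact .sum_pi (e := fun _ _ _ => 1) (.const 1)

theorem pcmd_greedyCmd : PCmd i₀ fun (_ : ι → ℕ) m => Q.greedyCmd β i₀ m :=
  (pcmd_roundCmd.iterate_pow Q.numRels).comp pcmd_initCmd

theorem pcmd_markCmd : PCmd i₀ fun (_ : ι → ℕ) m => Q.markCmd β i₀ m := by
  classical
  refine .fill (by omega) (fun _ i p m g => ?_) fun i => ?_
  · have h : ∀ c ≤ 4, Function.update m 7 g c = m c := fun c hc =>
      Function.update_of_ne (by omega) _ _
    simp only [isEdge_congr (h 0 (by omega)) (h 1 (by omega)), h 1 (by omega), h 4 (by omega),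
      lim_update i₀ m (show 7 ≠ 2 by omega)]
  · refine .ite ((PPred.lt (PExpr.var none) (.read 1 i (.const 0))).and
      (((PPred.const _).and (PPred.eq (.read 4 i (PExpr.var none)) (.const 0)).not).or
        ((PPred.const _).and ?_))) (.const 1) (.const 0)
    exact .exists_pi (p := fun y J m => Q.IsEdge m J ∧ J i = y none)
      (.and (ppred_isEdge fun c => .var (Sum.inr c)) (.eq (.var (Sum.inr i)) (.var (Sum.inl none))))

theorem pexpr_rank (i : Fin Q.numRels) {e : (ι → ℕ) → Blocks Q.numRels → ℕ}
    (he : PExpr i₀ e) : PExpr i₀ fun x m => Q.rank i₀ m i (e x m) :=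
  .sum (e := fun x j' m => if j' < e x m ∧ m 7 i j' ≠ 0 then 1 else 0)
    (.ite (.and (.lt (PExpr.var none) (he.reindex some))
      (PPred.eq (.read 7 i (PExpr.var none)) (.const 0)).not) (.const 1) (.const 0))

theorem pcmd_outputCmd : PCmd i₀ fun (_ : ι → ℕ) m => Q.outputCmd i₀ m := by
  refine (pcmd_copy (by omega) (by omega)).comp (PCmd.comp (.fill (by omega)
    (fun _ i p m g => ?_) fun i => ?_) (.fill (by omega) (fun _ i p m g => ?_) fun i => ?_))
  · rw [lim_update i₀ m (by omega), Function.update_of_ne (by omega)]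
  · exact .sum (e := fun _ j m => if m 7 i j ≠ 0 then 1 else 0)
      (.ite (PPred.eq (.read 7 i (PExpr.var none)) (.const 0)).not (.const 1) (.const 0))
  · simp only [rank, lim_update i₀ m (show 8 ≠ 2 by omega),
      Function.update_of_ne (show 7 ≠ 8 by omega), Function.update_of_ne (show 0 ≠ 8 by omega)]
    congr!
  · exact .sum (e := fun y j m => if m 7 i j ≠ 0 then
        ∑ c ∈ Finset.range (Q.attr i).card,
          if Q.rank i₀ m i j * (Q.attr i).card + c = y none then
            m 0 i (j * (Q.attr i).card + c) else 0 else 0)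
      (.ite (PPred.eq (.read 7 i (PExpr.var none)) (.const 0)).not
        (.sum_finset _ fun c _ => .ite
          (.eq (((pexpr_rank i (PExpr.var none)).mul_const _).add (.const c)) (.var (some none)))
          (.read 0 i (((PExpr.var none).mul_const _).add (.const c))) (.const 0)) (.const 0))

theorem pcmd_solveCmd : PCmd i₀ fun (_ : ι → ℕ) m => Q.solveCmd β i₀ m :=
  pcmd_outputCmd.comp (pcmd_markCmd.comp pcmd_greedyCmd)

end Computable

end CQ

/-! ### Agreement of the memory with the abstract hypergraph algorithm -/

namespace CQ

open RAM

section Cells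

variable {X : Finset ℕ}

theorem length_row (t : Tuple X) : (row t).length = X.card := List.length_ofFn

theorem length_cells (l : List (Tuple X)) : (cells l).length = l.length * X.card := by
  induction l with
  | nil => simp [cells]
  | cons t l ih =>
    rw [cells] at ih ⊢
    rw [List.flatMap_cons, List.length_append, ih, length_row, List.length_cons]
    ring

theorem getD_cells (l : List (Tuple X)) {j c : ℕ} (hj : j < l.length) (hc : c < X.card) :
    (cells l).getD (j * X.card + c) 0 = l.getD j 0 (X.orderIsoOfFin rfl ⟨c, hc⟩) := by
  induction l generalizing j with
  | nil => simp at hj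
  | cons t l ih =>
    rw [cells, List.flatMap_cons]
    cases j with
    | zero =>
      rw [zero_mul, zero_add, List.getD_append _ _ _ _ (by rwa [length_row]),
        List.getD_cons_zero, row, List.getD_eq_getElem _ _ (by simpa using hc),
        List.getElem_ofFn]
    | succ j =>
      have h : (j + 1) * X.card + c - X.card = j * X.card + c := by
        rw [add_mul, one_mul]; omega
      rw [List.getD_append_right _ _ _ _ (by rw [length_row, add_mul, one_mul]; omega),
        length_row, h, List.getD_cons_succ]
      exact ih (by simpa using hj)

theorem position_lt {a : ℕ} (ha : a ∈ X) : position X a < X.card := by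
  rw [position, dif_pos ha]
  exact Fin.is_lt _

theorem getD_cells_position (l : List (Tuple X)) {j a : ℕ} (hj : j < l.length) (ha : a ∈ X) :
    (cells l).getD (j * X.card + position X a) 0 = l.getD j 0 ⟨a, ha⟩ := by
  rw [getD_cells l hj (position_lt ha)]
  simp [position, ha]

end Cells

/-- The entry of row `j` of table `i` at attribute `a`. -/
def entry (Q : CQ) (T : Q.Tables) (i : Fin Q.numRels) (j a : ℕ) : ℕ :=
  if h : a ∈ Q.attr i then (T i).getD j 0 ⟨a, h⟩ else 0

/-- The joinable choices of one row from every table. -/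
def edges (Q : CQ) (T : Q.Tables) : Finset (Fin Q.numRels → ℕ) :=
  (Fintype.piFinset fun i => Finset.range (T i).length).filter fun J =>
    ∀ i i', ∀ a ∈ Q.attr i ∩ Q.attr i', Q.entry T i (J i) a = Q.entry T i' (J i') a

/-- The rows of an edge in the tables with the attribute `β`. -/
def edgeRows (Q : CQ) (β : ℕ) (J : Fin Q.numRels → ℕ) : Finset (Fin Q.numRels × ℕ) :=
  (Finset.univ.filter fun i => β ∈ Q.attr i).image fun i => (i, J i)

/-- The values of the output attributes on an edge. -/
def edgeOutput (Q : CQ) (T : Q.Tables) (J : Fin Q.numRels → ℕ) : Fin Q.numRels → ℕ → ℕ :=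
  fun i a => if a ∈ Q.attr i ∩ Q.head then Q.entry T i (J i) a else 0

/-- All rows of the tables with the attribute `β`. -/
def allRows (Q : CQ) (β : ℕ) (T : Q.Tables) : Finset (Fin Q.numRels × ℕ) :=
  (Finset.univ ×ˢ Finset.range (∑ i, (T i).length)).filter fun v =>
    β ∈ Q.attr v.1 ∧ v.2 < (T v.1).length

/-- The `β`-value of a row. -/
def color (Q : CQ) (β : ℕ) (T : Q.Tables) (v : Fin Q.numRels × ℕ) : ℕ := Q.entry T v.1 v.2 β

/-- The memory holds the tables, their lengths and a sufficiently large loop limit. -/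
structure Encodes (Q : CQ) (i₀ : Fin Q.numRels) (T : Q.Tables) (L : ℕ)
    (m : Blocks Q.numRels) : Prop where
  cell : ∀ i p, m 0 i p = (cells (T i)).getD p 0
  length : ∀ i, m 1 i 0 = (T i).length
  lim_eq : lim i₀ m = L
  pos : 0 < L
  length_le : ∀ i, (T i).length ≤ L
  total_le : Q.numRels * ∑ i, (T i).length ≤ L
  cells_le : ∀ i, (cells (T i)).length ≤ L

/-- The nonzero cells of block `K` below `L` are those in `A`. -/
def Marks {k : ℕ} (K L : ℕ) (A : Finset (Fin k × ℕ)) (m : Blocks k) : Prop :=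
  ∀ i, ∀ p < L, m K i p ≠ 0 ↔ (i, p) ∈ A

variable {Q : CQ} {β L d : ℕ} {i₀ : Fin Q.numRels} {T : Q.Tables} {m m' : Blocks Q.numRels}
  {S A : Finset (Fin Q.numRels × ℕ)} {J J' : Fin Q.numRels → ℕ}

theorem mem_edges : J ∈ Q.edges T ↔ (∀ i, J i < (T i).length) ∧
    ∀ i i', ∀ a ∈ Q.attr i ∩ Q.attr i', Q.entry T i (J i) a = Q.entry T i' (J i') a := by
  simp [edges]

theorem mem_edgeRows {v : Fin Q.numRels × ℕ} :
    v ∈ Q.edgeRows β J ↔ β ∈ Q.attr v.1 ∧ v.2 = J v.1 := by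
  obtain ⟨i, p⟩ := v
  simp only [edgeRows, Finset.mem_image, Finset.mem_filter, Finset.mem_univ, true_and,
    Prod.mk.injEq]
  constructor
  · rintro ⟨i', h, rfl, rfl⟩; exact ⟨h, rfl⟩
  · rintro ⟨h, rfl⟩; exact ⟨i, h, rfl, rfl⟩

theorem edgeRows_subset :
    Q.edgeRows β J ⊆ S ↔ ∀ i, β ∈ Q.attr i → (i, J i) ∈ S := by
  constructor
  · exact fun h i hi => h (mem_edgeRows.2 ⟨hi, rfl⟩)
  · rintro h ⟨i, p⟩ hv
    obtain ⟨h1, h2⟩ := mem_edgeRows.1 hv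
    dsimp only at h1 h2
    rw [h2]
    exact h i h1

theorem mem_allRows {v : Fin Q.numRels × ℕ} :
    v ∈ Q.allRows β T ↔ β ∈ Q.attr v.1 ∧ v.2 < (T v.1).length := by
  simp only [allRows, Finset.mem_filter, Finset.mem_product, Finset.mem_univ, true_and,
    Finset.mem_range, and_iff_right_iff_imp]
  exact fun h => h.2.trans_le
    (Finset.single_le_sum (f := fun i => (T i).length) (fun _ _ => Nat.zero_le _)
      (Finset.mem_univ v.1))

theorem edgeOutput_eq : Q.edgeOutput T J = Q.edgeOutput T J' ↔
    ∀ i, ∀ a ∈ Q.attr i ∩ Q.head, Q.entry T i (J i) a = Q.entry T i (J' i) a := by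
  constructor
  · intro h i a ha
    have := congr_fun (congr_fun h i) a
    simpa only [edgeOutput, if_pos ha] using this
  · intro h
    funext i a
    unfold edgeOutput
    split_ifs with ha
    · exact h i a ha
    · rfl

namespace Encodes

theorem congr (h : Q.Encodes i₀ T L m) (hm : ∀ c ≤ 2, m' c = m c) : Q.Encodes i₀ T L m' where
  cell i p := by rw [hm 0 (by omega), h.cell]
  length i := by rw [hm 1 (by omega), h.length]
  lim_eq := by rw [← h.lim_eq, RAM.lim, RAM.lim, hm 2 le_rfl]
  pos := h.pos
  length_le := h.length_le
  total_le := h.total_le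
  cells_le := h.cells_le

theorem fill (h : Q.Encodes i₀ T L m) {K : ℕ} (hK : 2 < K)
    (e : Fin Q.numRels → ℕ → Blocks Q.numRels → ℕ) : Q.Encodes i₀ T L (RAM.fill i₀ K e m) :=
  h.congr fun _ hc => fill_of_ne (by omega) _ _

theorem card_allRows_le (h : Q.Encodes i₀ T L m) : (Q.allRows β T).card ≤ L := by
  refine (Finset.card_filter_le _ _).trans (le_trans (le_of_eq ?_) h.total_le)
  simp

theorem card_edges_le (h : Q.Encodes i₀ T L m) : (Q.edges T).card ≤ L ^ Q.numRels := by
  refine (Finset.card_filter_le _ _).trans ?_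
  rw [Fintype.card_piFinset]
  refine (Finset.prod_le_prod' (g := fun _ => L) fun i _ => ?_).trans (by simp)
  simpa using h.length_le i

theorem value_eq (h : Q.Encodes i₀ T L m) {i : Fin Q.numRels} {j a : ℕ}
    (hj : j < (T i).length) (ha : a ∈ Q.attr i) : Q.value m i j a = Q.entry T i j a := by
  rw [value, h.cell, getD_cells_position _ hj ha, entry, dif_pos ha]

theorem isEdge_iff (h : Q.Encodes i₀ T L m) : Q.IsEdge m J ↔ J ∈ Q.edges T := by
  rw [mem_edges, IsEdge]
  simp only [h.length]
  refine and_congr_right fun hJ => forall_congr' fun i => forall_congr' fun i' =>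
    forall₂_congr fun a ha => ?_
  rw [Finset.mem_inter] at ha
  rw [h.value_eq (hJ i) ha.1, h.value_eq (hJ i') ha.2]

theorem lt_limit (h : Q.Encodes i₀ T L m) (hJ : J ∈ Q.edges T) (i : Fin Q.numRels) : J i < L :=
  ((mem_edges.1 hJ).1 i).trans_le (h.length_le i)

theorem sameOutput_iff (h : Q.Encodes i₀ T L m) (hJ : J ∈ Q.edges T) (hJ' : J' ∈ Q.edges T) :
    Q.SameOutput m J J' ↔ Q.edgeOutput T J = Q.edgeOutput T J' := by
  rw [edgeOutput_eq]
  refine forall_congr' fun i => forall₂_congr fun a ha => ?_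
  have ha' := (Finset.mem_inter.1 ha).1
  rw [h.value_eq ((mem_edges.1 hJ).1 i) ha', h.value_eq ((mem_edges.1 hJ').1 i) ha']

theorem isCovered_iff (h : Q.Encodes i₀ T L m) (hS : Marks 4 L S m) (hJ : J ∈ Q.edges T) :
    Q.IsCovered β i₀ m J ↔ ∃ J' ∈ Q.edges T, Q.edgeOutput T J' = Q.edgeOutput T J ∧
      Q.edgeRows β J' ⊆ S := by
  refine exists_congr fun J' => ?_
  rw [h.isEdge_iff, edgeRows_subset, h.lim_eq]
  constructor
  · rintro ⟨-, hJ', ho, hs⟩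
    exact ⟨hJ', (h.sameOutput_iff hJ' hJ).1 ho, fun i hi =>
      (hS i _ (h.lt_limit hJ' i)).1 (hs i hi)⟩
  · rintro ⟨hJ', ho, hs⟩
    exact ⟨h.lt_limit hJ', hJ', (h.sameOutput_iff hJ' hJ).2 ho, fun i hi =>
      (hS i _ (h.lt_limit hJ' i)).2 (hs i hi)⟩

/-- Edges only use indices below the limit, so the machine's bounded search over index tuples misses
none of them. -/
theorem rowDegree_eq (h : Q.Encodes i₀ T L m) (hS : Marks 4 L S m) (hA : Marks 5 L A m)
    {i : Fin Q.numRels} (hi : β ∈ Q.attr i) (p : ℕ) : Q.rowDegree β i₀ m i p =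
      HyperCover.degree (Q.edges T) (Q.edgeRows β) (Q.edgeOutput T) S A (i, p) := by
  classical
  rw [rowDegree, Finset.sum_boole, HyperCover.degree, Nat.cast_id]
  congr 1
  ext J
  simp only [Finset.mem_filter, Fintype.mem_piFinset, Finset.mem_range,
    HyperCover.mem_within, HyperCover.mem_uncovered, mem_edgeRows, edgeRows_subset, h.isEdge_iff,
    h.lim_eq, hi, true_and]
  constructor
  · rintro ⟨-, hp, hJ, hrows, hcov⟩
    exact ⟨⟨⟨hJ, fun hc => hcov ((h.isCovered_iff hS hJ).2 (by simpa only [edgeRows_subset]))⟩,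
      fun i' hi' => (hA i' _ (h.lt_limit hJ i')).1 (hrows i' hi')⟩, hp.symm⟩
  · rintro ⟨⟨⟨hJ, hcov⟩, hrows⟩, hp⟩
    exact ⟨h.lt_limit hJ, hp.symm, hJ, fun i' hi' =>
      (hA i' _ (h.lt_limit hJ i')).2 (hrows i' hi'), fun hc => hcov (by
        simpa only [edgeRows_subset] using (h.isCovered_iff hS hJ).1 hc)⟩

end Encodes

/-- The memory holds the threshold `d` and the selected rows `S`. -/
structure GreedyState (Q : CQ) (i₀ : Fin Q.numRels) (T : Q.Tables) (L d : ℕ)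
    (S : Finset (Fin Q.numRels × ℕ)) (m : Blocks Q.numRels) : Prop where
  encodes : Q.Encodes i₀ T L m
  threshold : m 3 i₀ 0 = d
  selected : Marks 4 L S m

theorem GreedyState.congr (h : Q.GreedyState i₀ T L d S m) (hm : ∀ c ≤ 4, m' c = m c) :
    Q.GreedyState i₀ T L d S m' where
  encodes := h.encodes.congr fun c hc => hm c (by omega)
  threshold := by rw [hm 3 (by omega), h.threshold]
  selected i p hp := by rw [hm 4 (by omega)]; exact h.selected i p hp

theorem GreedyState.peelCmd (h : Q.GreedyState i₀ T L d S m) (hA : Marks 5 L A m)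
    (hsub : A ⊆ Q.allRows β T) : Q.GreedyState i₀ T L d S (Q.peelCmd β i₀ m) ∧
      Marks 5 L (HyperCover.peel (Q.edges T) (Q.edgeRows β) (Q.edgeOutput T) d S A)
        (Q.peelCmd β i₀ m) := by
  refine ⟨h.congr fun c hc => ?_, fun i p hp => ?_⟩
  · rw [CQ.peelCmd, fill_of_ne (by omega), fill_of_ne (by omega)]
  · rw [CQ.peelCmd, fill_self _ _ _ (by rwa [lim_fill (by omega), h.encodes.lim_eq]),
      fill_self _ _ _ (by rwa [h.encodes.lim_eq]), HyperCover.mem_peel, ne_eq,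
      ite_eq_right_iff, Classical.not_imp, hA i p hp, h.threshold]
    refine Iff.trans (and_iff_left one_ne_zero) (and_congr_right fun hv => ?_)
    rw [h.encodes.rowDegree_eq h.selected hA (mem_allRows.1 (hsub hv)).1]

theorem GreedyState.startCmd (h : Q.GreedyState i₀ T L d S m) :
    Q.GreedyState i₀ T L d S (Q.startCmd β i₀ m) ∧
      Marks 5 L (Q.allRows β T) (Q.startCmd β i₀ m) := by
  refine ⟨h.congr fun c hc => fill_of_ne (by omega) _ _, fun i p hp => ?_⟩
  rw [CQ.startCmd, fill_self _ _ _ (by rwa [h.encodes.lim_eq]), mem_allRows, h.encodes.length]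
  simp

theorem GreedyState.iterate_peelCmd (h : Q.GreedyState i₀ T L d S m) (hA : Marks 5 L A m)
    (hsub : A ⊆ Q.allRows β T) (n : ℕ) :
    Q.GreedyState i₀ T L d S ((Q.peelCmd β i₀)^[n] m) ∧
      Marks 5 L ((HyperCover.peel (Q.edges T) (Q.edgeRows β) (Q.edgeOutput T) d S)^[n] A)
        ((Q.peelCmd β i₀)^[n] m) := by
  induction n generalizing m A with
  | zero => exact ⟨h, hA⟩
  | succ n ih =>
    obtain ⟨h1, h2⟩ := h.peelCmd hA hsub
    exact ih h1 h2 (HyperCover.peel_subset.trans hsub)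

theorem GreedyState.pickCmd (h : Q.GreedyState i₀ T L d S m) {j : ℕ} (hj : j < L) :
    Q.GreedyState i₀ T L d (HyperCover.pick (Q.edges T) (Q.edgeRows β) (Q.edgeOutput T)
      (Q.color β T) (Q.allRows β T) L d S (i₀, j)) (Q.pickCmd β i₀ j m) := by
  classical
  obtain ⟨h1, h2⟩ := h.startCmd (β := β)
  obtain ⟨h3, h4⟩ := h1.iterate_peelCmd h2 subset_rfl (lim i₀ (Q.startCmd β i₀ m))
  rw [h1.encodes.lim_eq] at h3 h4
  unfold CQ.pickCmd
  rw [h1.encodes.lim_eq]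
  set m₁ := (Q.peelCmd β i₀)^[L] (Q.startCmd β i₀ m)
  refine ⟨(h3.encodes.fill (by omega) _).fill (by omega) _, ?_, fun i p hp => ?_⟩
  · rw [fill_of_ne (by omega), fill_of_ne (by omega), h3.threshold]
  · rw [fill_self _ _ _ (by rwa [lim_fill (by omega), h3.encodes.lim_eq]),
      fill_self _ _ _ (by rwa [h3.encodes.lim_eq]), ne_eq, ite_eq_right_iff, Classical.not_imp,
      h3.selected i p hp, h4 i₀ j hj, h4 i p hp]
    refine Iff.trans (and_iff_left one_ne_zero) ?_
    rw [HyperCover.mem_pick]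
    refine or_congr_right (and_congr_right fun hc => and_congr_right fun hc' => ?_)
    have ha := mem_allRows.1 (HyperCover.core_subset hc)
    have ha' := mem_allRows.1 (HyperCover.core_subset hc')
    rw [h3.encodes.value_eq ha.2 ha.1, h3.encodes.value_eq ha'.2 ha'.1, color, color]

theorem GreedyState.foldl_pickCmd (h : Q.GreedyState i₀ T L d S m) (l : List ℕ)
    (hl : ∀ j ∈ l, j < L) :
    Q.GreedyState i₀ T L d ((l.map fun j => (i₀, j)).foldl (HyperCover.pick (Q.edges T)
      (Q.edgeRows β) (Q.edgeOutput T) (Q.color β T) (Q.allRows β T) L d) S)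
      (l.foldl (fun m j => Q.pickCmd β i₀ j m) m) := by
  induction l generalizing m S with
  | nil => exact h
  | cons j l ih =>
    exact ih (h.pickCmd (hl j (by simp))) fun j' hj' => hl j' (by simp [hj'])

theorem GreedyState.roundCmd (h : Q.GreedyState i₀ T L d S m) :
    Q.GreedyState i₀ T L (d - 1) (((List.range L).map fun j => (i₀, j)).foldl
      (HyperCover.pick (Q.edges T) (Q.edgeRows β) (Q.edgeOutput T) (Q.color β T)
        (Q.allRows β T) L d) S) (Q.roundCmd β i₀ m) := by
  have h1 := h.foldl_pickCmd (β := β) (List.range L) fun j => List.mem_range.1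
  unfold CQ.roundCmd
  rw [h.encodes.lim_eq]
  refine ⟨(h1.encodes.fill (by omega) _).fill (by omega) _, ?_, fun i p hp => ?_⟩
  · rw [fill_self _ _ _ (by rw [lim_fill (by omega), h1.encodes.lim_eq]; exact h.encodes.pos),
      fill_self _ _ _ (by rw [h1.encodes.lim_eq]; exact h.encodes.pos), h1.threshold]
  · rw [fill_of_ne (by omega), fill_of_ne (by omega)]
    exact h1.selected i p hp

/-- For `inj`, each attribute of a row is either an output attribute, fixed by the output, or `β`,
fixed by the colour through the join condition. Equal rows have equal indices as the tables have no
duplicates. -/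
theorem colored (hβ : Q.nonOutput = {β}) (hi₀ : β ∈ Q.attr i₀) (hT : ∀ i, (T i).Nodup) :
    HyperCover.Colored (Q.edges T) (Q.edgeRows β) (Q.edgeOutput T) (Q.color β T)
      (Q.allRows β T) Q.numRels where
  nonempty J _ := ⟨(i₀, J i₀), mem_edgeRows.2 ⟨hi₀, rfl⟩⟩
  subset J hJ v hv := by
    obtain ⟨h1, h2⟩ := mem_edgeRows.1 hv
    exact mem_allRows.2 ⟨h1, h2 ▸ (mem_edges.1 hJ).1 v.1⟩
  card_le J _ := Finset.card_image_le.trans ((Finset.card_filter_le _ _).trans (by simp))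
  col_eq J hJ v hv w hw := by
    obtain ⟨h1, h2⟩ := mem_edgeRows.1 hv
    obtain ⟨h3, h4⟩ := mem_edgeRows.1 hw
    rw [color, color, h2, h4]
    exact (mem_edges.1 hJ).2 _ _ β (Finset.mem_inter.2 ⟨h1, h3⟩)
  inj J hJ J' hJ' v hv w hw hc ho := by
    obtain ⟨h1, h2⟩ := mem_edgeRows.1 hv
    obtain ⟨h3, h4⟩ := mem_edgeRows.1 hw
    rw [color, color, h2, h4] at hc
    rw [edgeOutput_eq] at ho
    funext i
    have hJi := (mem_edges.1 hJ).1 i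
    have hJi' := (mem_edges.1 hJ').1 i
    have hrow : (T i).getD (J i) 0 = (T i).getD (J' i) 0 := by
      funext ⟨a, ha⟩
      have : Q.entry T i (J i) a = Q.entry T i (J' i) a := by
        by_cases hh : a ∈ Q.head
        · exact ho i a (Finset.mem_inter.2 ⟨ha, hh⟩)
        · have hab : a ∈ Q.nonOutput :=
            Finset.mem_sdiff.2 ⟨Q.attr_subset_attrs i ha, hh⟩
          rw [hβ, Finset.mem_singleton] at hab
          subst hab
          rw [(mem_edges.1 hJ).2 i v.1 a (Finset.mem_inter.2 ⟨ha, h1⟩), hc,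
            (mem_edges.1 hJ').2 w.1 i a (Finset.mem_inter.2 ⟨h3, ha⟩)]
      simpa only [entry, dif_pos ha] using this
    rw [List.getD_eq_getElem _ _ hJi, List.getD_eq_getElem _ _ hJi'] at hrow
    exact (hT i).getElem_inj_iff.1 hrow

/-- The initial threshold `L ^ Q.numRels` is at least the number of edges, so the invariant holds
trivially for the empty selection. Each round lowers the threshold by one, down to 0. -/
theorem greedyCmd_spec (hβ : Q.nonOutput = {β}) (hi₀ : β ∈ Q.attr i₀) (hT : ∀ i, (T i).Nodup)
    (h : Q.Encodes i₀ T L m) (hm : m 4 = 0) :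
    ∃ S, Q.GreedyState i₀ T L 0 S (Q.greedyCmd β i₀ m) ∧
      HyperCover.Inv (Q.edges T) (Q.edgeRows β) (Q.edgeOutput T) (Q.allRows β T)
        Q.numRels 0 S := by
  have h0 : Q.GreedyState i₀ T L (L ^ Q.numRels) ∅ (Q.initCmd i₀ m) := by
    refine ⟨h.fill (by omega) _, ?_, fun i p hp => ?_⟩
    · rw [initCmd, fill_self _ _ _ (by rw [h.lim_eq]; exact h.pos), h.lim_eq]
      simp [Fintype.card_piFinset]
    · rw [initCmd, fill_of_ne (by omega), hm]
      simp
  have hstep : ∀ n ≤ L ^ Q.numRels, ∃ S,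
      Q.GreedyState i₀ T L (L ^ Q.numRels - n) S ((Q.roundCmd β i₀)^[n] (Q.initCmd i₀ m)) ∧
      HyperCover.Inv (Q.edges T) (Q.edgeRows β) (Q.edgeOutput T) (Q.allRows β T)
        Q.numRels (L ^ Q.numRels - n) S := by
    intro n
    induction n with
    | zero => exact fun _ => ⟨∅, h0, HyperCover.inv_empty h.card_edges_le⟩
    | succ n ih =>
      intro hn
      obtain ⟨S, h1, h2⟩ := ih (by omega)
      have hd : L ^ Q.numRels - n = (L ^ Q.numRels - (n + 1)) + 1 := by omega
      have h3 := h1.roundCmd (β := β)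
      rw [hd] at h2 h3
      rw [Function.iterate_succ_apply']
      refine ⟨_, h3, h2.round (colored hβ hi₀ hT) h.card_allRows_le _ fun J hJ => ?_⟩
      -- Table `i₀` has the attribute `β`, so every edge has a vertex in it and its rows suffice as
      -- seeds.
      exact ⟨(i₀, J i₀), List.mem_map.2 ⟨J i₀, List.mem_range.2 (h.lt_limit hJ i₀), rfl⟩,
        mem_edgeRows.2 ⟨hi₀, rfl⟩⟩
  obtain ⟨S, h1, h2⟩ := hstep _ le_rfl
  rw [Nat.sub_self] at h1 h2
  refine ⟨S, ?_, h2⟩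
  rw [greedyCmd, show lim i₀ (Q.initCmd i₀ m) = L from h0.encodes.lim_eq]
  exact h1

/-- The rows of the solution: the selected rows, and all rows that are used by an edge in the
tables without the attribute `β`. -/
def InSolution (Q : CQ) (β : ℕ) (T : Q.Tables) (S : Finset (Fin Q.numRels × ℕ))
    (i : Fin Q.numRels) (p : ℕ) : Prop :=
  (β ∈ Q.attr i ∧ (i, p) ∈ S) ∨ (β ∉ Q.attr i ∧ ∃ J ∈ Q.edges T, J i = p)

open Classical in
/-- The indices of the rows of the solution. -/
noncomputable def solutionRows (Q : CQ) (β : ℕ) (T : Q.Tables)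
    (S : Finset (Fin Q.numRels × ℕ)) (i : Fin Q.numRels) : List ℕ :=
  (List.range (T i).length).filter fun p => Q.InSolution β T S i p

/-- The tables of the solution. -/
noncomputable def solution (Q : CQ) (β : ℕ) (T : Q.Tables) (S : Finset (Fin Q.numRels × ℕ)) :
    Q.Tables :=
  fun i => (Q.solutionRows β T S i).map fun p => (T i).getD p 0

theorem mem_solutionRows {i : Fin Q.numRels} {p : ℕ} : p ∈ Q.solutionRows β T S i ↔
    p < (T i).length ∧ Q.InSolution β T S i p := by
  simp [solutionRows]

theorem nodup_solutionRows (i : Fin Q.numRels) : (Q.solutionRows β T S i).Nodup :=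
  List.nodup_range.filter _

theorem GreedyState.markCmd (h : Q.GreedyState i₀ T L d S m) :
    Q.Encodes i₀ T L (Q.markCmd β i₀ m) ∧
      ∀ i, ∀ p < L, Q.markCmd β i₀ m 7 i p ≠ 0 ↔ p ∈ Q.solutionRows β T S i := by
  classical
  refine ⟨h.encodes.fill (by omega) _, fun i p hp => ?_⟩
  rw [CQ.markCmd, fill_self _ _ _ (by rwa [h.encodes.lim_eq]), mem_solutionRows, ne_eq,
    ite_eq_right_iff, Classical.not_imp, h.selected i p hp, h.encodes.length, h.encodes.lim_eq,
    InSolution]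
  refine Iff.trans (and_iff_left one_ne_zero) (and_congr_right fun _ => or_congr_right
    (and_congr_right fun _ => exists_congr fun J => ?_))
  rw [h.encodes.isEdge_iff]
  exact ⟨fun hJ => hJ.2, fun hJ => ⟨h.encodes.lt_limit hJ.1, hJ⟩⟩

/-- The rows are listed in increasing order of index, so the number of solution rows before `j` is
the place of `j` in the list. -/
theorem rank_eq (h : Q.Encodes i₀ T L m)
    (hm : ∀ i, ∀ p < L, m 7 i p ≠ 0 ↔ p ∈ Q.solutionRows β T S i) {i : Fin Q.numRels} {j : ℕ}
    (hj : j ∈ Q.solutionRows β T S i) :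
    (Q.solutionRows β T S i)[Q.rank i₀ m i j]? = some j := by
  classical
  have hj' := (mem_solutionRows.1 hj)
  have hr : Q.rank i₀ m i j =
      ((List.range j).filter fun p => Q.InSolution β T S i p).length := by
    rw [rank, Finset.sum_boole, Nat.cast_id, h.lim_eq,
      ← List.toFinset_card_of_nodup (List.nodup_range.filter _)]
    congr 1
    ext p
    simp only [Finset.mem_filter, Finset.mem_range, List.mem_toFinset, List.mem_filter,
      List.mem_range, decide_eq_true_eq]
    constructor
    · rintro ⟨hp, hpj, h7⟩
      exact ⟨hpj, (mem_solutionRows.1 ((hm i p hp).1 h7)).2⟩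
    · rintro ⟨hpj, hs⟩
      have hp := hpj.trans hj'.1
      have hpL := hp.trans_le (h.length_le i)
      exact ⟨hpL, hpj, (hm i p hpL).2 (mem_solutionRows.2 ⟨hp, hs⟩)⟩
  obtain ⟨n, hn⟩ : ∃ n, (T i).length = j + (n + 1) := ⟨(T i).length - j - 1, by omega⟩
  rw [hr, solutionRows, hn, List.range_add, List.filter_append,
    List.getElem?_append_right le_rfl, Nat.sub_self, List.range_succ_eq_map]
  simp [hj'.2]

theorem outputCmd_spec (h : Q.Encodes i₀ T L m)
    (hm : ∀ i, ∀ p < L, m 7 i p ≠ 0 ↔ p ∈ Q.solutionRows β T S i) (i : Fin Q.numRels) :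
    Q.outputCmd i₀ m 9 i 0 = (Q.solution β T S i).length ∧
      ∀ q < (cells (Q.solution β T S i)).length,
        Q.outputCmd i₀ m 0 i q = (cells (Q.solution β T S i)).getD q 0 := by
  classical
  have hrows : ∀ p ∈ Q.solutionRows β T S i, p < L := fun p hp =>
    (mem_solutionRows.1 hp).1.trans_le (h.length_le i)
  refine ⟨?_, fun q hq => ?_⟩
  · rw [outputCmd, fill_of_ne (by omega),
      fill_self _ _ _ (by rw [lim_fill (by omega), h.lim_eq]; exact h.pos), lim_fill (by omega),
      fill_of_ne (by omega), Finset.sum_boole, Nat.cast_id, h.lim_eq, solution, List.length_map,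
      ← List.toFinset_card_of_nodup (nodup_solutionRows i)]
    congr 1
    ext p
    rw [Finset.mem_filter, Finset.mem_range, List.mem_toFinset]
    exact ⟨fun hp => (hm i p hp.1).1 hp.2, fun hp => ⟨hrows p hp, (hm i p (hrows p hp)).2 hp⟩⟩
  · have hlen : (Q.solution β T S i).length ≤ (T i).length := by
      rw [solution, List.length_map, solutionRows]
      exact (List.length_filter_le _ _).trans (by simp)
    have hqL : q < L := by
      refine hq.trans_le (le_trans ?_ (h.cells_le i))
      rw [length_cells, length_cells]
      exact Nat.mul_le_mul_right _ hlen
    rw [length_cells] at hq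
    have hw : 0 < (Q.attr i).card := Nat.pos_of_ne_zero fun h0 => by simp [h0] at hq
    set w := (Q.attr i).card with hwdef
    have hr : q / w < (Q.solution β T S i).length := Nat.div_lt_of_lt_mul (by rwa [mul_comm])
    have hc : q % w < w := Nat.mod_lt _ hw
    have hdiv : q / w * w + q % w = q := by rw [mul_comm]; exact Nat.div_add_mod q w
    have hr' : q / w < (Q.solutionRows β T S i).length := by
      simpa [solution] using hr
    set j₀ := (Q.solutionRows β T S i)[q / w] with hj₀
    have hj₀mem : j₀ ∈ Q.solutionRows β T S i := List.getElem_mem hr'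
    -- By division with remainder, output cell `q` receives a contribution only from row `j₀` and
    -- column `q % w`; hence both sums of the output command reduce to one term.
    have hrank : ∀ j ∈ Q.solutionRows β T S i, ∀ c < w, Q.rank i₀ m i j * w + c = q →
        j = j₀ ∧ c = q % w := by
      intro j hj c hcw heq
      have h1 : Q.rank i₀ m i j = q / w := by
        rw [← heq, mul_comm, Nat.mul_add_div hw, Nat.div_eq_of_lt hcw, add_zero]
      have h2 := rank_eq h hm hj
      rw [h1, List.getElem?_eq_getElem hr', Option.some_inj] at h2
      refine ⟨h2.symm, ?_⟩
      rw [← heq, mul_comm, Nat.mul_add_mod, Nat.mod_eq_of_lt hcw]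
    have hrank₀ : Q.rank i₀ m i j₀ = q / w := by
      have h2 := rank_eq h hm hj₀mem
      obtain ⟨hlt, h3⟩ := List.getElem?_eq_some_iff.1 h2
      exact (nodup_solutionRows i).getElem_inj_iff.1 h3
    rw [outputCmd, fill_self _ _ _ (by
        rwa [lim_fill (by omega), lim_fill (by omega), h.lim_eq]), fill_of_ne (by omega),
      fill_self _ _ _ (by rwa [h.lim_eq]), h.lim_eq,
      Finset.sum_eq_single j₀, if_pos ((hm i j₀ (hrows _ hj₀mem)).2 hj₀mem),
      Finset.sum_eq_single (q % w), if_pos (by rw [hrank₀]; exact hdiv), h.cell]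
    · have hlt := (mem_solutionRows.1 hj₀mem).1
      rw [getD_cells _ hlt hc]
      conv_rhs => rw [← hdiv, getD_cells _ hr hc]
      have hsol : (Q.solution β T S i).getD (q / w) 0 = (T i).getD j₀ 0 := by
        rw [List.getD_eq_getElem _ _ hr, hj₀]
        simp [solution]
      rw [hsol]
    · intro c hc' hne
      rw [if_neg]
      exact fun heq => hne (hrank j₀ hj₀mem c (Finset.mem_range.1 hc') heq).2
    · exact fun hnot => absurd (Finset.mem_range.2 hc) hnot
    · intro j hj hne
      split_ifs with h7
      · refine Finset.sum_eq_zero fun c hc' => if_neg fun heq => hne ?_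
        exact (hrank j ((hm i j (Finset.mem_range.1 hj)).1 h7) c (Finset.mem_range.1 hc') heq).1
      · rfl
    · exact fun hnot => absurd (Finset.mem_range.2 (hrows _ hj₀mem)) hnot

theorem solveCmd_spec (hβ : Q.nonOutput = {β}) (hi₀ : β ∈ Q.attr i₀) (hT : ∀ i, (T i).Nodup)
    (h : Q.Encodes i₀ T L m) (hm : m 4 = 0) :
    ∃ S, HyperCover.Inv (Q.edges T) (Q.edgeRows β) (Q.edgeOutput T) (Q.allRows β T)
        Q.numRels 0 S ∧
      ∀ i, Q.solveCmd β i₀ m 9 i 0 = (Q.solution β T S i).length ∧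
        ∀ q < (cells (Q.solution β T S i)).length,
          Q.solveCmd β i₀ m 0 i q = (cells (Q.solution β T S i)).getD q 0 := by
  obtain ⟨S, h1, h2⟩ := greedyCmd_spec hβ hi₀ hT h hm
  obtain ⟨h3, h4⟩ := h1.markCmd (β := β)
  exact ⟨S, h2, fun i => outputCmd_spec h3 h4 i⟩

end CQ

/-! ### Edges, witnesses and the approximation ratio -/

namespace CQ

open RAM

section Correctness

variable {Q : CQ} {β : ℕ} {i₀ : Fin Q.numRels} {T : Q.Tables} {D Dstar : Q.Database}
  {S : Finset (Fin Q.numRels × ℕ)} {J J' : Fin Q.numRels → ℕ}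

theorem exists_rel_of_mem_attrs {a : ℕ} (ha : a ∈ Q.attrs) : ∃ i, a ∈ Q.attr i := by
  simpa [attrs] using ha

/-- The tuple that the rows of an edge join to. -/
noncomputable def edgeTuple (Q : CQ) (T : Q.Tables) (J : Fin Q.numRels → ℕ) : Tuple Q.attrs :=
  fun a => Q.entry T (exists_rel_of_mem_attrs a.2).choose
    (J (exists_rel_of_mem_attrs a.2).choose) a

theorem edgeTuple_apply (hJ : J ∈ Q.edges T) {i : Fin Q.numRels} (a : Q.attrs)
    (ha : a.1 ∈ Q.attr i) : Q.edgeTuple T J a = Q.entry T i (J i) a :=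
  (mem_edges.1 hJ).2 _ _ _
    (Finset.mem_inter.2 ⟨(exists_rel_of_mem_attrs a.2).choose_spec, ha⟩)

theorem proj_edgeTuple (hJ : J ∈ Q.edges T) (i : Fin Q.numRels) :
    proj (Q.attr_subset_attrs i) (Q.edgeTuple T J) = (T i).getD (J i) 0 := by
  funext ⟨a, ha⟩
  rw [proj, edgeTuple_apply hJ _ ha, entry, dif_pos ha]

theorem exists_edge_of_mem_join (hT : Q.Lists T D) {s : Tuple Q.attrs} (hs : s ∈ Q.join D) :
    ∃ J ∈ Q.edges T, ∀ i, (T i).getD (J i) 0 = proj (Q.attr_subset_attrs i) s := by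
  have h : ∀ i, ∃ j, j < (T i).length ∧
      (T i).getD j 0 = proj (Q.attr_subset_attrs i) s := fun i => by
    have hi := hs i
    rw [← (hT i).2, List.mem_toFinset] at hi
    obtain ⟨j, hj, hj'⟩ := List.getElem_of_mem hi
    exact ⟨j, hj, by rw [List.getD_eq_getElem _ _ hj, hj']⟩
  choose J hJ hJs using h
  refine ⟨J, mem_edges.2 ⟨hJ, fun i i' a ha => ?_⟩, hJs⟩
  obtain ⟨h1, h2⟩ := Finset.mem_inter.1 ha
  rw [entry, entry, dif_pos h1, dif_pos h2, hJs, hJs]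
  rfl

theorem edgeOutput_eq_iff (hJ : J ∈ Q.edges T) (hJ' : J' ∈ Q.edges T) :
    Q.edgeOutput T J = Q.edgeOutput T J' ↔
      proj Q.head_subset_attrs (Q.edgeTuple T J) = proj Q.head_subset_attrs (Q.edgeTuple T J') := by
  rw [edgeOutput_eq]
  constructor
  · rintro h
    funext ⟨a, ha⟩
    obtain ⟨i, hi⟩ := exists_rel_of_mem_attrs (Q.head_subset_attrs ha)
    rw [proj, proj, edgeTuple_apply hJ _ hi, edgeTuple_apply hJ' _ hi]
    exact h i a (Finset.mem_inter.2 ⟨hi, ha⟩)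
  · intro h i a ha
    obtain ⟨hi, ha⟩ := Finset.mem_inter.1 ha
    have := congr_fun h ⟨a, ha⟩
    rwa [proj, proj, edgeTuple_apply hJ _ hi, edgeTuple_apply hJ' _ hi] at this

theorem edgeTuple_eq (hJ : J ∈ Q.edges T) {s : Tuple Q.attrs}
    (h : ∀ i, (T i).getD (J i) 0 = proj (Q.attr_subset_attrs i) s) : Q.edgeTuple T J = s := by
  funext a
  obtain ⟨i, hi⟩ := exists_rel_of_mem_attrs a.2
  rw [edgeTuple_apply hJ a hi, entry, dif_pos hi, h]
  rfl

theorem getD_mem (hT : Q.Lists T D) {i : Fin Q.numRels} {j : ℕ} (hj : j < (T i).length) :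
    (T i).getD j 0 ∈ D i := by
  rw [← (hT i).2, List.mem_toFinset, List.getD_eq_getElem _ _ hj]
  exact List.getElem_mem hj

theorem getD_inj (hT : Q.Lists T D) {i : Fin Q.numRels} {j j' : ℕ} (hj : j < (T i).length)
    (hj' : j' < (T i).length) (h : (T i).getD j 0 = (T i).getD j' 0) : j = j' := by
  rw [List.getD_eq_getElem _ _ hj, List.getD_eq_getElem _ _ hj'] at h
  exact (hT i).1.getElem_inj_iff.1 h

theorem edgeTuple_mem_join (hT : Q.Lists T D) (hJ : J ∈ Q.edges T) :
    Q.edgeTuple T J ∈ Q.join D := fun i => by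
  rw [proj_edgeTuple hJ]
  exact getD_mem hT ((mem_edges.1 hJ).1 i)

/-- The database of the solution. -/
noncomputable def solutionDatabase (Q : CQ) (β : ℕ) (T : Q.Tables)
    (S : Finset (Fin Q.numRels × ℕ)) : Q.Database :=
  fun i => (Q.solution β T S i).toFinset

theorem lists_solution (hT : Q.Lists T D) :
    Q.Lists (Q.solution β T S) (Q.solutionDatabase β T S) := fun i =>
  ⟨(nodup_solutionRows i).map_on fun _ hj _ hj' h =>
    getD_inj hT (mem_solutionRows.1 hj).1 (mem_solutionRows.1 hj').1 h, rfl⟩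

theorem mem_solutionDatabase {i : Fin Q.numRels} {t : Tuple (Q.attr i)} :
    t ∈ Q.solutionDatabase β T S i ↔
      ∃ p ∈ Q.solutionRows β T S i, (T i).getD p 0 = t := by
  simp [solutionDatabase, solution]

theorem join_mono {D' : Q.Database} (h : ∀ i, D' i ⊆ D i) : Q.join D' ⊆ Q.join D :=
  fun _ hs i => h i (hs i)

/-- An output tuple comes from an edge; feasibility provides an edge with the same output whose
`β`-rows are selected, and its other rows are kept anyway. -/
theorem isWitness_solution (hT : Q.Lists T D)
    (hf : HyperCover.Feasible (Q.edges T) (Q.edgeRows β) (Q.edgeOutput T) S) :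
    Q.IsWitness D (Q.solutionDatabase β T S) := by
  have hsub : ∀ i, Q.solutionDatabase β T S i ⊆ D i := by
    intro i t ht
    obtain ⟨p, hp, rfl⟩ := mem_solutionDatabase.1 ht
    exact getD_mem hT (mem_solutionRows.1 hp).1
  refine ⟨hsub, Set.Subset.antisymm (Set.image_mono (join_mono hsub)) ?_⟩
  rintro _ ⟨s, hs, rfl⟩
  obtain ⟨J, hJ, hJs⟩ := exists_edge_of_mem_join hT hs
  obtain ⟨J', hJ', ho, hS⟩ := hf J hJ
  rw [edgeOutput_eq_iff hJ' hJ, edgeTuple_eq hJ hJs] at ho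
  refine ⟨Q.edgeTuple T J', fun i => ?_, ho⟩
  rw [proj_edgeTuple hJ']
  refine mem_solutionDatabase.2 ⟨J' i, mem_solutionRows.2 ⟨(mem_edges.1 hJ').1 i, ?_⟩, rfl⟩
  by_cases hi : β ∈ Q.attr i
  · exact .inl ⟨hi, edgeRows_subset.1 hS i hi⟩
  · exact .inr ⟨hi, J', hJ', rfl⟩

/-- Every edge has the output of an edge of the witness. -/
theorem exists_edge_of_isWitness (hT : Q.Lists T D) (hD : Q.IsWitness D Dstar)
    (hJ : J ∈ Q.edges T) : ∃ J' ∈ Q.edges T, Q.edgeOutput T J' = Q.edgeOutput T J ∧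
      ∀ i, (T i).getD (J' i) 0 ∈ Dstar i := by
  have h1 : proj Q.head_subset_attrs (Q.edgeTuple T J) ∈ Q.result Dstar := by
    rw [hD.2]
    exact ⟨_, edgeTuple_mem_join hT hJ, rfl⟩
  obtain ⟨s, hs, hsJ⟩ := h1
  obtain ⟨J', hJ', hJs⟩ := exists_edge_of_mem_join hT (join_mono hD.1 hs)
  refine ⟨J', hJ', ?_, fun i => ?_⟩
  · rw [edgeOutput_eq_iff hJ' hJ, edgeTuple_eq hJ' hJs, hsJ]
  · rw [hJs]
    exact hs i

/-- In a table without `β`, all attributes are output attributes. Two edges with equal outputs then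
use the same row there, so a row used by some edge occurs in every witness. -/
theorem length_solutionRows_le (hβ : Q.nonOutput = {β}) (hT : Q.Lists T D)
    (hD : Q.IsWitness D Dstar) (i : Fin Q.numRels) :
    (Q.solutionRows β T S i).length ≤ (S.filter fun v => v.1 = i).card + (Dstar i).card := by
  rw [← List.toFinset_card_of_nodup (nodup_solutionRows i)]
  by_cases hi : β ∈ Q.attr i
  · refine le_trans (Finset.card_le_card_of_injOn (fun p => (i, p)) (fun p hp => ?_)
      fun p _ p' _ h => (Prod.mk.inj h).2) (Nat.le_add_right _ _)
    rw [Finset.mem_coe, List.mem_toFinset] at hp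
    rcases (mem_solutionRows.1 hp).2 with h | h
    · exact Finset.mem_coe.2 (Finset.mem_filter.2 ⟨h.2, rfl⟩)
    · exact absurd hi h.1
  · refine le_trans (Finset.card_le_card_of_injOn (fun p => (T i).getD p 0) (fun p hp => ?_)
      fun p hp p' hp' h => ?_) (Nat.le_add_left _ _)
    · rw [Finset.mem_coe, List.mem_toFinset] at hp
      rcases (mem_solutionRows.1 hp).2 with h | ⟨-, J, hJ, rfl⟩
      · exact absurd h.1 hi
      · obtain ⟨J', hJ', ho, hmem⟩ := exists_edge_of_isWitness hT hD hJ
        have : (T i).getD (J i) 0 = (T i).getD (J' i) 0 := by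
          funext ⟨a, ha⟩
          have hh : a ∈ Q.head := by
            by_contra hh
            have hab : a ∈ Q.nonOutput := Finset.mem_sdiff.2 ⟨Q.attr_subset_attrs i ha, hh⟩
            rw [hβ, Finset.mem_singleton] at hab
            exact hi (hab ▸ ha)
          have := edgeOutput_eq.1 ho i a (Finset.mem_inter.2 ⟨ha, hh⟩)
          simpa only [entry, dif_pos ha] using this.symm
        dsimp only
        rw [this]
        exact hmem i
    · rw [Finset.mem_coe, List.mem_toFinset] at hp hp'
      exact getD_inj hT (mem_solutionRows.1 hp).1 (mem_solutionRows.1 hp').1 h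

theorem size_eq_sum_length {T' : Q.Tables} (hT : Q.Lists T' D) :
    D.size = ∑ i, (T' i).length :=
  Finset.sum_congr rfl fun i _ => by
    rw [← (hT i).2, List.toFinset_card_of_nodup (hT i).1]

theorem card_edges_le_size_pow (hT : Q.Lists T D) :
    (Q.edges T).card ≤ D.size ^ Q.numRels := by
  refine (Finset.card_filter_le _ _).trans ?_
  rw [Fintype.card_piFinset]
  refine (Finset.prod_le_prod' (g := fun _ => D.size) fun i _ => ?_).trans (by simp)
  rw [Finset.card_range, size_eq_sum_length hT]
  exact Finset.single_le_sum (f := fun i => (T i).length) (fun _ _ => Nat.zero_le _)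
    (Finset.mem_univ i)

/-- The approximation ratio of the greedy algorithm. -/
noncomputable def ratio (k N : ℕ) : ℝ := k * (1 + k * Real.log N) + 1

theorem ratio_isBigO (k : ℕ) : ratio k =O[atTop] fun N : ℕ => Real.log (N : ℝ) := by
  have hc : ∀ c : ℝ, (fun _ : ℕ => c) =O[atTop] fun N : ℕ => Real.log (N : ℝ) := fun c =>
    ((Real.isLittleO_const_log_atTop (c := c)).comp_tendsto tendsto_natCast_atTop_atTop).isBigO
  have h : (fun N : ℕ => (k : ℝ) * (k * Real.log N)) =O[atTop]
      fun N : ℕ => Real.log (N : ℝ) :=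
    ((isBigO_refl _ _).const_mul_left _).const_mul_left _
  refine ((hc (k + 1)).add h).congr_left fun N => ?_
  rw [ratio]
  ring

theorem isApproxSmallestWitness_solution (hβ : Q.nonOutput = {β}) (hi₀ : β ∈ Q.attr i₀)
    (hT : Q.Lists T D)
    (hS : HyperCover.Inv (Q.edges T) (Q.edgeRows β) (Q.edgeOutput T) (Q.allRows β T)
      Q.numRels 0 S) :
    Q.IsApproxSmallestWitness (ratio Q.numRels D.size) D (Q.solutionDatabase β T S) := by
  classical
  have hcol := colored (T := T) hβ hi₀ fun i => (hT i).1
  refine ⟨isWitness_solution hT (hS.feasible hcol), fun Dstar hD => ?_⟩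
  -- The `β`-rows of a smallest witness form the feasible set that the greedy selection is compared
  -- with.
  set R := (Q.allRows β T).filter fun v => (T v.1).getD v.2 0 ∈ Dstar v.1 with hR
  have hfeas : HyperCover.Feasible (Q.edges T) (Q.edgeRows β) (Q.edgeOutput T) R := by
    intro J hJ
    obtain ⟨J', hJ', ho, hmem⟩ := exists_edge_of_isWitness hT hD.1 hJ
    exact ⟨J', hJ', ho, edgeRows_subset.2 fun i hi => Finset.mem_filter.2
      ⟨mem_allRows.2 ⟨hi, (mem_edges.1 hJ').1 i⟩, hmem i⟩⟩
  have hRcard : R.card ≤ Dstar.size := by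
    rw [Finset.card_eq_sum_card_fiberwise (f := Prod.fst) (t := Finset.univ)
      fun _ _ => Finset.mem_coe.2 (Finset.mem_univ _)]
    refine Finset.sum_le_sum fun i _ => Finset.card_le_card_of_injOn
      (fun v => (T i).getD v.2 0) ?_ ?_
    · rintro ⟨i', p⟩ hv
      obtain ⟨hvR, rfl⟩ := Finset.mem_filter.1 (Finset.mem_coe.1 hv)
      exact (Finset.mem_filter.1 hvR).2
    · rintro ⟨i', p⟩ hv ⟨i'', p'⟩ hv' h
      obtain ⟨hvR, rfl⟩ := Finset.mem_filter.1 (Finset.mem_coe.1 hv)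
      obtain ⟨hvR', h'⟩ := Finset.mem_filter.1 (Finset.mem_coe.1 hv')
      dsimp only at h'
      subst h'
      exact congrArg _ (getD_inj hT (mem_allRows.1 (Finset.mem_filter.1 hvR).1).2
        (mem_allRows.1 (Finset.mem_filter.1 hvR').1).2 h)
  have hsize : (Q.solutionDatabase β T S).size ≤ S.card + Dstar.size := by
    rw [size_eq_sum_length (lists_solution hT),
      Finset.card_eq_sum_card_fiberwise (s := S) (f := Prod.fst) (t := Finset.univ)
        fun _ _ => Finset.mem_coe.2 (Finset.mem_univ _), Database.size, ← Finset.sum_add_distrib]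
    refine Finset.sum_le_sum fun i _ => ?_
    rw [solution, List.length_map]
    exact length_solutionRows_le hβ hT hD.1 i
  have hlog : Real.log (Q.edges T).card ≤ Q.numRels * Real.log D.size := by
    -- Without edges the logarithm takes its default value 0 and the bound still holds.
    rcases Nat.eq_zero_or_pos (Q.edges T).card with h0 | hpos
    · rw [h0, Nat.cast_zero, Real.log_zero]
      exact mul_nonneg (Nat.cast_nonneg _) (Real.log_natCast_nonneg _)
    · rw [← Real.log_pow]
      exact Real.log_le_log (by exact_mod_cast hpos)
        (by exact_mod_cast card_edges_le_size_pow hT)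
  have hScard := hS.card_le (Finset.filter_subset _ _) hfeas
  have hsize' : ((Q.solutionDatabase β T S).size : ℝ) ≤ S.card + Dstar.size := by
    exact_mod_cast hsize
  have hlog0 := Real.log_natCast_nonneg (Q.edges T).card
  calc ((Q.solutionDatabase β T S).size : ℝ)
      ≤ Q.numRels * (1 + Real.log (Q.edges T).card) * R.card + Dstar.size := by linarith
    _ ≤ Q.numRels * (1 + Q.numRels * Real.log D.size) * Dstar.size + Dstar.size := by
        gcongr
    _ = ratio Q.numRels D.size * Dstar.size := by rw [ratio]; ring

end Correctness

/-! ### The complete program -/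

section Machine

variable {k : ℕ}

/-- Run the programs of a list one after the other. -/
def seqList : List Prog → Prog
  | [] => .skip
  | P :: l => .seq P (seqList l)

/-- The accumulator is not among the summands, so these stay unchanged. Repeating registers in the
list replaces multiplication by a constant. -/
theorem exec_add_list {a : ℕ} (l : List ℕ) (ha : a ∉ l) (s : State) :
    ∃ s', Exec (seqList (l.map fun i => .add a a i)) s (l.length + 1) s' ∧ s'.mem = s.mem ∧
      (∀ z, z ≠ a → s'.reg z = s.reg z) ∧ s'.reg a = s.reg a + (l.map s.reg).sum := by
  induction l generalizing s with
  | nil => exact ⟨s, .skip s, rfl, fun _ _ => rfl, by simp⟩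
  | cons i l ih =>
    simp only [List.mem_cons, not_or] at ha
    obtain ⟨s', hx, hm, hr, hv⟩ := ih ha.2 (s.setReg a (s.reg a + s.reg i))
    refine ⟨s', ?_, hm, fun z hz => ?_, ?_⟩
    · rw [List.length_cons, add_comm l.length 1, add_assoc]
      exact .seq (.add _ _ _ _) hx
    · rw [hr z hz, State.setReg_reg, if_neg hz]
    · have : l.map (s.setReg a (s.reg a + s.reg i)).reg = l.map s.reg :=
        List.map_congr_left fun z hz => by
          rw [State.setReg_reg, if_neg (fun h : z = a => ha.2 (h ▸ hz))]
      rw [hv, this, State.setReg_reg, if_pos rfl, List.map_cons, List.sum_cons, add_assoc]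

theorem exec_store_list (K b : ℕ) (l : List (Fin k)) (s : State) :
    ∃ s', Exec (seqList (l.map fun i : Fin k => .store (K * k + i) b i)) s (l.length + 1) s' ∧
      s'.reg = s.reg ∧ (∀ K' ≠ K, view k s'.mem K' = view k s.mem K') ∧
      (∀ i, i ∉ l → view k s'.mem K i = view k s.mem K i) ∧
      ∀ i ∈ l, view k s'.mem K i (s.reg b) = s.reg i := by
  induction l generalizing s with
  | nil => exact ⟨s, .skip s, rfl, fun _ _ => rfl, fun _ _ => rfl, by simp⟩
  | cons c l ih =>
    obtain ⟨s', hx, hr, hK, hi, hv⟩ := ih (s.setMem (K * k + c) (s.reg b) (s.reg c))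
    refine ⟨s', ?_, by simpa using hr, fun K' hK' => ?_, fun i hil => ?_, fun i hil => ?_⟩
    · rw [List.length_cons, add_comm l.length 1, add_assoc]
      exact .seq (.store _ _ _ _) hx
    · rw [hK K' hK', view_setMem, setCell, Function.update_of_ne hK']
    · simp only [List.mem_cons, not_or] at hil
      rw [hi i hil.2, view_setMem, setCell, Function.update_self, Function.update_of_ne hil.1]
    · by_cases h : i ∈ l
      · simpa using hv i h
      · obtain rfl : i = c := by simpa [h] using hil
        rw [hi i h, view_setMem]
        simp [setCell]

theorem exec_load_list (K : ℕ) (l : List (Fin k)) (s : State) (hl : l.Nodup) :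
    ∃ s', Exec (seqList (l.map fun i : Fin k => .load i (K * k + i) k)) s (l.length + 1) s' ∧
      s'.mem = s.mem ∧ (∀ z, (∀ i ∈ l, z ≠ (i : ℕ)) → s'.reg z = s.reg z) ∧
      ∀ i ∈ l, s'.reg i = view k s.mem K i (s.reg k) := by
  induction l generalizing s with
  | nil => exact ⟨s, .skip s, rfl, fun _ _ => rfl, by simp⟩
  | cons c l ih =>
    rw [List.nodup_cons] at hl
    obtain ⟨s', hx, hm, hr, hv⟩ := ih (s.setReg c (s.mem (K * k + c) (s.reg k))) hl.2
    refine ⟨s', ?_, hm, fun z hz => ?_, fun i hil => ?_⟩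
    · rw [List.length_cons, add_comm l.length 1, add_assoc]
      exact .seq (.load _ _ _ _) hx
    · rw [hr z fun i hi => hz i (List.mem_cons_of_mem _ hi), State.setReg_reg,
        if_neg (hz c List.mem_cons_self)]
    · by_cases h : i ∈ l
      · rw [hv i h, State.setReg_reg, if_neg c.2.ne', State.setReg_mem]
      · obtain rfl : i = c := by simpa [h] using hil
        rw [hr i fun j hj hij => h (Fin.ext hij ▸ hj), State.setReg_reg, if_pos rfl]
        rfl

theorem view_inputState (Q : CQ) (T : Q.Tables) (i : Fin Q.numRels) (p : ℕ) :
    view Q.numRels (Q.inputState T).mem 0 i p = (cells (T i)).getD p 0 := by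
  simp [view, inputState]

theorem view_inputState_of_ne (Q : CQ) (T : Q.Tables) {K : ℕ} (hK : K ≠ 0) :
    view Q.numRels (Q.inputState T).mem K = 0 := by
  funext i p
  have : ¬K * Q.numRels + i < Q.numRels := by
    have := Nat.le_mul_of_pos_left Q.numRels (Nat.pos_of_ne_zero hK)
    omega
  simp [view, inputState, this]

/-- The factor between the size of the database and the loop limit. -/
def limitFactor (Q : CQ) : ℕ := Q.numRels + ∑ i, (Q.attr i).card

/-- The program that copies the lengths of the tables to the memory and computes the limit. -/
def prologue (Q : CQ) (i₀ : Fin Q.numRels) : Prog :=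
  .seq (.const (Q.numRels + 1) 1)
    (.seq (seqList ((List.replicate Q.limitFactor
        ((List.finRange Q.numRels).map Fin.val)).flatten.map fun i =>
          .add (Q.numRels + 1) (Q.numRels + 1) i))
      (.seq (.store (2 * Q.numRels + i₀) Q.numRels (Q.numRels + 1))
        (seqList ((List.finRange Q.numRels).map fun i : Fin Q.numRels =>
          .store (1 * Q.numRels + i) Q.numRels i))))

/-- The prologue is straight-line code, so its running time depends on the query alone. The
accumulator starts at 1, which makes the limit positive even for an empty database. -/
theorem exec_prologue (Q : CQ) (i₀ : Fin Q.numRels) : ∃ n, ∀ T : Q.Tables, ∃ s,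
    Exec (Q.prologue i₀) (Q.inputState T) n s ∧
      Q.Encodes i₀ T (Q.limitFactor * (∑ i, (T i).length) + 1) (view Q.numRels s.mem) ∧
      view Q.numRels s.mem 4 = 0 := by
  refine ⟨1 + ((List.replicate Q.limitFactor
    ((List.finRange Q.numRels).map Fin.val)).flatten.length + 1 +
      (1 + ((List.finRange Q.numRels).length + 1))), fun T => ?_⟩
  set l := (List.replicate Q.limitFactor ((List.finRange Q.numRels).map Fin.val)).flatten with hl
  have hmem : ∀ z ∈ l, z < Q.numRels := by
    intro z hz
    simp only [hl, List.mem_flatten, List.mem_replicate] at hz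
    obtain ⟨_, ⟨-, rfl⟩, hz⟩ := hz
    obtain ⟨i, -, rfl⟩ := List.mem_map.1 hz
    exact i.2
  set s₁ := (Q.inputState T).setReg (Q.numRels + 1) 1 with hs₁
  obtain ⟨s₂, hx₂, hm₂, hr₂, hv₂⟩ := exec_add_list (a := Q.numRels + 1) l
    (fun h => absurd (hmem _ h) (by omega)) s₁
  set s₃ := s₂.setMem (2 * Q.numRels + i₀) (s₂.reg Q.numRels) (s₂.reg (Q.numRels + 1)) with hs₃
  obtain ⟨s₄, hx₄, hr₄, hK₄, -, hv₄⟩ := exec_store_list 1 Q.numRels (List.finRange Q.numRels) s₃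
  refine ⟨s₄, .seq (.const _ _ _) (.seq hx₂ (.seq (.store _ _ _ _) hx₄)), ?_, ?_⟩
  · have hreg : ∀ i : Fin Q.numRels, s₁.reg i = (T i).length := fun i => by
      rw [hs₁, State.setReg_reg, if_neg (by omega)]
      simp [inputState]
    -- Register `Q.numRels` is the first one without input; it is still 0 and serves as the address
    -- of the cells written here.
    have hz : s₂.reg Q.numRels = 0 := by
      rw [hr₂ _ (by omega), hs₁, State.setReg_reg, if_neg (by omega)]
      simp [inputState]
    have hsum : (l.map s₁.reg).sum = Q.limitFactor * ∑ i, (T i).length := by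
      rw [hl, List.map_flatten, List.map_replicate, List.sum_flatten, List.map_replicate,
        List.sum_replicate, smul_eq_mul, List.map_map]
      congr 1
      rw [Fin.sum_univ_def]
      congr 1
      exact List.map_congr_left fun i _ => hreg i
    have hlimit : s₂.reg (Q.numRels + 1) = Q.limitFactor * (∑ i, (T i).length) + 1 := by
      rw [hv₂, hsum, hs₁, State.setReg_reg, if_pos rfl, add_comm]
    have hle : ∀ i, (T i).length ≤ ∑ i, (T i).length := fun i =>
      Finset.single_le_sum (f := fun i => (T i).length) (fun _ _ => Nat.zero_le _)
        (Finset.mem_univ i)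
    have hk : Q.numRels ≤ Q.limitFactor := Nat.le_add_right _ _
    have hw : ∀ i, (Q.attr i).card ≤ Q.limitFactor := fun i =>
      (Finset.single_le_sum (f := fun i => (Q.attr i).card) (fun _ _ => Nat.zero_le _)
        (Finset.mem_univ i)).trans (Nat.le_add_left _ _)
    refine ⟨fun i p => ?_, fun i => ?_, ?_, by omega, fun i => ?_, ?_, fun i => ?_⟩
    · rw [hK₄ 0 (by omega), hs₃, view_setMem, setCell, Function.update_of_ne (by omega), hm₂,
        hs₁, State.setReg_mem, view_inputState]
    · have h := hv₄ i (List.mem_finRange i)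
      rw [hs₃, State.setMem_reg, hz, hr₂ _ (by omega), hreg] at h
      exact h
    · rw [RAM.lim, hK₄ 2 (by omega), hs₃, view_setMem, hz, hlimit]
      simp [setCell]
    · calc (T i).length ≤ 1 * ∑ i, (T i).length := by rw [one_mul]; exact hle i
        _ ≤ Q.limitFactor * ∑ i, (T i).length :=
          Nat.mul_le_mul_right _ (le_trans (by have := i.2; omega) hk)
        _ ≤ _ := Nat.le_succ _
    · exact (Nat.mul_le_mul_right _ hk).trans (Nat.le_succ _)
    · rw [length_cells, mul_comm]
      exact (Nat.mul_le_mul (hw i) (hle i)).trans (Nat.le_succ _)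
  · rw [hK₄ 4 (by omega), hs₃, view_setMem, setCell, Function.update_of_ne (by omega), hm₂,
      hs₁, State.setReg_mem, view_inputState_of_ne Q T (by omega)]

theorem swpApproximable_ratio {Q : CQ} {β : ℕ} (hβ : Q.nonOutput = {β}) :
    Q.SWPApproximable (ratio Q.numRels) := by
  obtain ⟨i₀, hi₀⟩ : ∃ i, β ∈ Q.attr i := by
    refine exists_rel_of_mem_attrs (Finset.mem_sdiff.1 (?_ : β ∈ Q.nonOutput)).1
    rw [hβ]
    exact Finset.mem_singleton_self β
  obtain ⟨n₁, hprologue⟩ := exec_prologue Q i₀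
  obtain ⟨P, p, hP⟩ := (pcmd_solveCmd (β := β) (i₀ := i₀) (ι := Empty)).2 Empty.elim 0 nofun
  refine ⟨.seq (Q.prologue i₀) (.seq P (.seq (.const Q.numRels 0)
    (seqList ((List.finRange Q.numRels).map fun i : Fin Q.numRels => .load i (9 * Q.numRels + i) Q.numRels)))),
    -- The loop limit is `limitFactor * N + 1`; the constant counts the prologue, the reset of the
    -- address register and the final loading of the table lengths.
    p.comp (Polynomial.C Q.limitFactor * Polynomial.X + 1) +
      Polynomial.C (n₁ + (Q.numRels + 2)), fun D T hT => ?_⟩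
  obtain ⟨s₁, hx₁, henc, h4⟩ := hprologue T
  obtain ⟨n₂, s₂, hx₂, hn₂, -, hv₂⟩ := hP s₁
  obtain ⟨S, hS, hout⟩ := solveCmd_spec hβ hi₀ (fun i => (hT i).1) henc h4
  replace hv₂ : view Q.numRels s₂.mem = Q.solveCmd β i₀ (view Q.numRels s₁.mem) := hv₂
  rw [← hv₂] at hout
  obtain ⟨s₃, hx₃, hm₃, -, hr₃⟩ := exec_load_list 9 (List.finRange Q.numRels)
    (s₂.setReg Q.numRels 0) (List.nodup_finRange _)
  refine ⟨_, s₃, Q.solutionDatabase β T S, Q.solution β T S,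
    .seq hx₁ (.seq hx₂ (.seq (.const _ _ _) hx₃)), ?_, fun i => ⟨?_, fun q hq => ?_⟩,
    lists_solution hT, isApproxSmallestWitness_solution hβ hi₀ hT hS⟩
  · rw [henc.lim_eq, ← size_eq_sum_length hT] at hn₂
    simp only [Polynomial.eval_add, Polynomial.eval_comp, Polynomial.eval_mul, Polynomial.eval_C,
      Polynomial.eval_X, Polynomial.eval_one, List.length_finRange]
    omega
  · rw [hr₃ i (List.mem_finRange i), State.setReg_reg, if_pos rfl, State.setReg_mem]
    exact (hout i).1
  · rw [hm₃, State.setReg_mem]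
    have := (hout i).2 q hq
    simpa [view] using this

end Machine

end CQ

theorem mainTheorem4 (Q : CQ) (hQ : Q.nonOutput.card = 1) :
    ∃ θ : ℕ → ℝ, θ =O[atTop] (fun N : ℕ => Real.log (N : ℝ)) ∧ Q.SWPApproximable θ := by
  obtain ⟨β, hβ⟩ := Finset.card_eq_one.1 hQ
  exact ⟨_, CQ.ratio_isBigO Q.numRels, CQ.swpApproximable_ratio hβ⟩
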